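/- **Setting.** Let $a<b$, $\gamma\in(\tfrac13,\tfrac12)$, $\delta\in(0,1]$ with $\delta+\gamma>1$. For $f:[a,b]\to\mathbb R$ put $[f]_\delta=\sup_{x\ne y}|f(x)-f(y)|/|x-y|^\delta$ and $\|f\|_\delta=\|f\|_\infty+[f]_\delta$, and let $C^\delta$ be the set of $f$ with $\|f\|_\delta<\infty$. Let $$\Omega_\gamma=\{\omega\in C([a,b],\mathbb R):\ \omega_a=0,\ [\omega]_\gamma<\infty\},$$ with the trace $\mathcal F_\gamma$ of the Borel $\sigma$-field of $(C([a,b],\mathbb R),\|\cdot\|_\infty)$. Let $S$ be a topological space with its Borel $\sigma$-field and $\pi_0$ a probability measure on $S$ (the prior). Let $\sigma:[a,b]\to\mathbb R$ satisfy $\sigma^2\in C^\delta$ and $\sigma^2(x)>0$ for all $x$. Let $\widetilde W:[a,b]\times S\to\mathbb R$ (the market maker's belief) be such that $\widetilde W(\cdot,s)\in C^\delta$ for every $s$ and $s\mapsto\widetilde W(\cdot,s)$ is continuous from $S$ to $(C^\delta,\|\cdot\|_\delta)$. Let $\eta:[a,b]\times S\to\mathbb R$; $\eta(x,s)$ is the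 expected payoff of security $x$ given signal $s$. Under the belief, on some probability space there are a signal $\mathbf s$ with law $\pi_0$, a standard Brownian motion $B$ independent of $\mathbf s$ (started at $0$ at the left end point $a$), and a random element $Y$ of $\Omega_\gamma$ (the cumulative order flow) with $$Y_x=\int_a^x\widetilde W(y,\mathbf s)\,dy+\int_a^x\sigma(y)\,dB_y\quad\text{a.s., for each } x\in[a,b],$$ where the Itô integral of the deterministic function $\sigma$ is the limit in probability of the left-point Riemann sums, $\sum_k \sigma(x_k)(B_{x_{k+1}\wedge x}-B_{x_k\wedge x})$ as the mesh of the partition tends to zero. The market maker's posterior is the conditional law of $\mathbf s$ given $Y$. A zero-profit price of security $x$ is a measurable function $p$ on $\Omega_\gamma$ with $p(Y)=\mathbb E[\eta(x,\mathbf s)\mid Y]$ a.s. For $\omega\in\Omega_\gamma$ and $s\in S$ write $$\Pi(\omega,s)=\int_a^b\frac{\widetilde W(x,s)}{\sigma^2(x)}\,d\omega_x=\lim_{\text{mesh}\to0}\sum_k\frac{\widetilde W(x_k,s)}{\sigma^2(x_k)}\,(\omega_{x_{k+1}}-\omega_{x_k}),$$ $$L(\omega,s)=\exp\Bigl\{\Pi(\omega,s)-\tfrac12\int_a^b\frac{\widetilde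 W(x,s)^2}{\sigma^2(x)}\,dx\Bigr\},\qquad C(\omega)=\int_S L(\omega,u)\,\pi_0(du)\in[0,\infty],$$ $$\pi_1(ds,\omega)=\frac1{C(\omega)}\,L(\omega,s)\,\pi_0(ds),$$ where $\pi_1(\cdot,\omega)$ is taken to be the zero measure if $C(\omega)=\infty$. **Theorem.** 1. For every $\omega\in\Omega_\gamma$ and $s\in S$, the limit of Riemann sums defining the pathwise (Young) integral $\Pi(\omega,s)$ exists. 2. $C(\omega)>0$ for every $\omega\in\Omega_\gamma$. Moreover $C(\omega)<\infty$ for almost every $\omega$ under the law of $Y$, and also under the law of any random element $Z$ of $\Omega_\gamma$ with $dZ_x=V(x)\,dx+\sigma(x)\,dB_x$, where $V\in C^\delta$ is deterministic (in particular for pure noise, $V=0$). If $\sup_s\|\widetilde W(\cdot,s)\|_\delta<\infty$, then $C(\omega)<\infty$ for every $\omega\in\Omega_\gamma$. Whenever $C(\omega)<\infty$, $\pi_1(\cdot,\omega)$ is a probability measure. 3. The market maker's posterior is $\pi_1$: there is a Markov kernel from $\Omega_\gamma$ to $S$ that is a regular conditional law of $\mathbf s$ given $Y$, equals $\pi_1(\cdot,\omega)$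 for every $\omega\in\Omega_\gamma$ with $C(\omega)<\infty$, and depends on $\omega$ only through the projection profile $(\Pi(\omega,s))_{s\in S}$. Also $\pi_1(\cdot,\omega)$ itself depends on $\omega$ only through the projection profile. Conversely, if a Markov kernel $\kappa$ is a regular conditional law of $\mathbf s$ given $Y$, then for each measurable $A\subseteq S$, $\kappa(\omega,A)=\pi_1(A,\omega)$ for almost every $\omega$ under the law of $Y$; if the $\sigma$-field of $S$ is countably generated, then $\kappa(\omega,\cdot)=\pi_1(\cdot,\omega)$ for almost every $\omega$. 4. For every $x\in[a,b]$ such that $\eta(x,\cdot)$ is $\pi_0$-integrable, $\eta(x,\cdot)$ is $\pi_1(\cdot,\omega)$-integrable for almost every $\omega$ under the law of $Y$, and $$P(x,\omega)=\int_S\eta(x,s)\,\pi_1(ds,\omega)$$ is a zero-profit price of security $x$; every zero-profit price of security $x$ equals it for almost every $\omega$ under the law of $Y$. -/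

import Mathlib

open MeasureTheory ProbabilityTheory Filter Topology
open scoped NNReal ENNReal

noncomputable section

namespace OrderFlow

/-- Lebesgue measure on the interval `[a, b]`. -/
def lebesgue (a b : ℝ) : Measure (Set.Icc a b) :=
  (volume : Measure ℝ).comap Subtype.val

/-- A partition `a = x₀ < x₁ < ⋯ < x_n = b` of the interval `[a, b]`. -/
structure IntervalPartition (a b : ℝ) where
  n : ℕ
  pt : Fin (n + 1) → Set.Icc a b
  strictMono : StrictMono pt
  first : (pt 0 : ℝ) = a
  last : (pt (Fin.last n) : ℝ) = b

/-- The mesh `max_k (x_{k+1} - x_k)`. -/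
def IntervalPartition.mesh {a b : ℝ} (P : IntervalPartition a b) : ℝ :=
  ⨆ k : Fin P.n, ((P.pt k.succ : ℝ) - (P.pt k.castSucc : ℝ))

/-- The filter on partitions of `[a, b]` describing the limit `mesh → 0`. -/
def meshFilter (a b : ℝ) : Filter (IntervalPartition a b) :=
  comap IntervalPartition.mesh (𝓝 0)

/-- The left-point Riemann sum `∑_k f(x_k) (g(x_{k+1}) - g(x_k))`. -/
def leftSum {a b : ℝ} (P : IntervalPartition a b) (f g : Set.Icc a b → ℝ) : ℝ :=
  ∑ k : Fin P.n, f (P.pt k.castSucc) * (g (P.pt k.succ) - g (P.pt k.castSucc))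

/-- `I` is the pathwise (Young) integral `∫_a^b f dg`: the limit of the left-point Riemann sums
as the mesh tends to zero. -/
def HasYoungIntegral {a b : ℝ} (f g : Set.Icc a b → ℝ) (I : ℝ) : Prop :=
  Tendsto (fun P => leftSum P f g) (meshFilter a b) (𝓝 I)

/-- The value of the pathwise integral `∫_a^b f dg` (meaningful when the limit exists). -/
def youngIntegral {a b : ℝ} (f g : Set.Icc a b → ℝ) : ℝ :=
  limUnder (meshFilter a b) (fun P => leftSum P f g)

/-- The Hölder norm `‖f‖_∞ + [f]_δ`, with value `∞` if `f` is not `δ`-Hölder. -/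
def holderNorm {X : Type*} [PseudoEMetricSpace X] (δ : ℝ≥0) (f : X → ℝ) : ℝ≥0∞ :=
  (⨆ x, ‖f x‖ₑ) + eHolderNorm δ f

/-- The space of `γ`-Hölder continuous paths on `[a, b]` that vanish at `a`. -/
def HolderPath (a b : ℝ) (γ : ℝ≥0) : Type :=
  {ω : C(Set.Icc a b, ℝ) // (∀ x : Set.Icc a b, (x : ℝ) = a → ω x = 0) ∧ MemHolder γ ω}

instance {a b : ℝ} {γ : ℝ≥0} : CoeFun (HolderPath a b γ) (fun _ => Set.Icc a b → ℝ) :=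
  ⟨fun ω => ω.1⟩

/-- The trace on the Hölder paths of the Borel σ-field of `C([a, b], ℝ)` with the sup norm. -/
instance {a b : ℝ} {γ : ℝ≥0} : MeasurableSpace (HolderPath a b γ) :=
  (borel C(Set.Icc a b, ℝ)).comap Subtype.val

/-- `I` is the Itô integral `∫_a^x f dB` of the deterministic function `f`, where the Brownian
motion `B` is started at the left end `a`, i.e. evaluated at time `y - a` at the point `y`: the limit
in probability of the left-point Riemann sums of `f` against `y ↦ B_{y ∧ x}`. -/
def IsItoIntegral {a b : ℝ} {Ξ : Type*} [MeasurableSpace Ξ] (μ : Measure Ξ)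
    (f : Set.Icc a b → ℝ) (B : ℝ≥0 → Ξ → ℝ) (x : Set.Icc a b) (I : Ξ → ℝ) : Prop :=
  TendstoInMeasure μ
    (fun (P : IntervalPartition a b) (ξ : Ξ) =>
      leftSum P f (fun y => B (Real.toNNReal ((min y x : Set.Icc a b) - a)) ξ))
    (meshFilter a b) I

/-- `Y` solves `dY_x = D_x dx + σ(x) dB_x`, `Y_a = 0`, that is,
`Y_x = ∫_a^x D_y dy + ∫_a^x σ(y) dB_y` for all `x ∈ [a, b]`. -/
def IsOrderFlow {a b : ℝ} {γ : ℝ≥0} {Ξ : Type*} [MeasurableSpace Ξ] (μ : Measure Ξ)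
    (σ : Set.Icc a b → ℝ) (B : ℝ≥0 → Ξ → ℝ) (D : Set.Icc a b → Ξ → ℝ)
    (Y : Ξ → HolderPath a b γ) : Prop :=
  ∀ x : Set.Icc a b, IsItoIntegral μ σ B x (fun ξ => Y ξ x - ∫ y in Set.Iic x, D y ξ ∂(lebesgue a b))

section Posterior

variable {a b : ℝ} {γ : ℝ≥0} {S : Type*}

/-- The projection coefficient `∫_a^b W(x, s) / σ²(x) dω_x`. -/
def projectionProfile (σ : Set.Icc a b → ℝ) (W : Set.Icc a b → S → ℝ)
    (ω : HolderPath a b γ) (s : S) : ℝ :=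
  youngIntegral (fun x => W x s / σ x ^ 2) ω

/-- The weight `exp (∫ W(x, s) / σ²(x) dω_x - ½ ∫ W(x, s)² / σ²(x) dx)`. -/
def likelihood (σ : Set.Icc a b → ℝ) (W : Set.Icc a b → S → ℝ)
    (ω : HolderPath a b γ) (s : S) : ℝ :=
  Real.exp (projectionProfile σ W ω s - 1 / 2 * ∫ x : Set.Icc a b, W x s ^ 2 / σ x ^ 2 ∂(lebesgue a b))

variable [MeasurableSpace S]

/-- The normalizing constant `C(ω; W) = ∫_S (weight of s) π₀(ds)`, possibly `∞`. -/
def normalizer (σ : Set.Icc a b → ℝ) (W : Set.Icc a b → S → ℝ) (π₀ : Measure S)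
    (ω : HolderPath a b γ) : ℝ≥0∞ :=
  ∫⁻ s, ENNReal.ofReal (likelihood σ W ω s) ∂π₀

/-- The measure `C(ω; W)⁻¹ (weight of s) π₀(ds)`. -/
def posterior (σ : Set.Icc a b → ℝ) (W : Set.Icc a b → S → ℝ) (π₀ : Measure S)
    (ω : HolderPath a b γ) : Measure S :=
  (normalizer σ W π₀ ω)⁻¹ • π₀.withDensity (fun s => ENNReal.ofReal (likelihood σ W ω s))

end Posterior

/-- `p` is a zero-profit (break-even) pricing rule for a security with payoff `V` when the order flow
is `Y`: the price is the conditional expectation of the payoff given the order flow. -/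
def IsZeroProfitPrice {Ξ E : Type*} [MeasurableSpace Ξ] [MeasurableSpace E] (μ : Measure Ξ)
    (Y : Ξ → E) (V : Ξ → ℝ) (p : E → ℝ) : Prop :=
  Integrable V μ ∧ Measurable p ∧
    μ[V | MeasurableSpace.comap Y inferInstance] =ᵐ[μ] fun ξ => p (Y ξ)

end OrderFlow

end

open OrderFlow

/-!
Why the theorem holds.

*Pathwise integrals.* If `f` is `δ`-Hölder and `g` is `γ`-Hölder with `δ + γ > 1`, the germ
`f(u) (g(v) - g(u))` is almost additive with an error of order `θ = δ + γ > 1`, so a discrete sewing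
argument bounds the Riemann sum over a partition of `[u, v]` minus the germ by a multiple of
`(v - u) ^ θ`. Comparing two partitions cell by cell makes the Riemann sums Cauchy as the mesh tends
to zero; this is `exists_hasYoungIntegral`, and the quantitative form `abs_youngIntegral_le` bounds
the likelihood uniformly in the signal when the belief is bounded in Hölder norm.

*The noise.* Itô integrals of the deterministic function `σ` are limits in probability of Gaussian
sums. Hence the noise part `M` of the order flow, obtained path by path by subtracting the drift, is
a centered Gaussian process with covariance `∫_a^{min x y} σ²`
(`isCenteredGaussian_of_isItoIntegral`), and it is independent of the signal. This determines its
law `P₀` on path space, because the σ-field there is generated by the evaluations.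

*Change of measure.* For a drift `w`, the variable `Π = ∫ (w / σ²) dω` is a pathwise limit of
Riemann sums, thus jointly Gaussian with the coordinates under `P₀`, with variance `∫ w² / σ²` and
covariance `∫_a^x w` with the coordinate at `x`. Comparing characteristic functions, tilting a
Gaussian process by `exp (Π - Var Π / 2)` shifts it by its covariance with `Π`
(`map_withDensity_exp_eq_map_add`). So the law of noise plus drift has density
`exp (Π - ½ ∫ w² / σ²)` with respect to `P₀` (`map_shift_eq_withDensity`), and the joint law of
order flow and signal has the likelihood as density with respect to `P₀ × π₀`
(`map_prodMk_eq_withDensity_likelihood`).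

*Bayes' formula.* From the joint density everything else follows by Tonelli's theorem: the law of
the order flow has density `C` with respect to `P₀`, whence `C` is finite `P₀`-almost everywhere and
so almost everywhere for every law that is absolutely continuous with respect to `P₀`; the
normalized likelihoods form a conditional law of the signal (`hasCondDistrib_bayesKernel`); and
conditional expectations of payoffs are the integrals against it.
-/

/-! ### Partitions and their mesh -/

namespace OrderFlow

section Partition

variable {a b : ℝ}

/-- The partition points as a sequence indexed by `ℕ`, eventually constant equal to `b`. -/
def IntervalPartition.seq (P : IntervalPartition a b) (k : ℕ) : Set.Icc a b :=
  P.pt ⟨min k P.n, by omega⟩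

lemma IntervalPartition.seq_monotone (P : IntervalPartition a b) : Monotone P.seq := by
  intro i j hij
  exact P.strictMono.monotone (by simp only [Fin.mk_le_mk]; omega)

lemma IntervalPartition.seq_zero (P : IntervalPartition a b) : (P.seq 0 : ℝ) = a := by
  refine Eq.trans ?_ P.first
  unfold IntervalPartition.seq
  congr 2

lemma IntervalPartition.seq_n (P : IntervalPartition a b) : (P.seq P.n : ℝ) = b := by
  refine Eq.trans ?_ P.last
  unfold IntervalPartition.seq
  congr 2
  exact Fin.ext (by simp)

lemma IntervalPartition.seq_zero_le (P : IntervalPartition a b) (x : Set.Icc a b) :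
    P.seq 0 ≤ x := by
  rw [← Subtype.coe_le_coe, P.seq_zero]
  exact x.2.1

lemma IntervalPartition.le_seq_n (P : IntervalPartition a b) (x : Set.Icc a b) :
    x ≤ P.seq P.n := by
  rw [← Subtype.coe_le_coe, P.seq_n]
  exact x.2.2

lemma IntervalPartition.seq_castSucc (P : IntervalPartition a b) (k : Fin P.n) :
    P.pt k.castSucc = P.seq k := by
  unfold IntervalPartition.seq
  congr 1
  exact Fin.ext (by have := k.2; simp only [Fin.val_castSucc]; omega)

lemma IntervalPartition.seq_succ (P : IntervalPartition a b) (k : Fin P.n) :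
    P.pt k.succ = P.seq (k + 1) := by
  unfold IntervalPartition.seq
  congr 1
  exact Fin.ext (by have := k.2; simp only [Fin.val_succ]; omega)

lemma leftSum_eq_sum_range (P : IntervalPartition a b) (f g : Set.Icc a b → ℝ) :
    leftSum P f g =
      ∑ k ∈ Finset.range P.n, f (P.seq k) * (g (P.seq (k + 1)) - g (P.seq k)) := by
  rw [Finset.sum_range]
  exact Finset.sum_congr rfl fun k _ => by rw [P.seq_castSucc, P.seq_succ]

lemma IntervalPartition.sub_le_mesh (P : IntervalPartition a b) {k : ℕ} (hk : k < P.n) :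
    (P.seq (k + 1) : ℝ) - P.seq k ≤ P.mesh := by
  have h := le_ciSup (f := fun k : Fin P.n => ((P.pt k.succ : ℝ) - (P.pt k.castSucc : ℝ)))
    (Set.finite_range _).bddAbove ⟨k, hk⟩
  simp only [P.seq_castSucc, P.seq_succ] at h
  exact h.trans_eq (by simp only [IntervalPartition.mesh, P.seq_castSucc, P.seq_succ])

lemma IntervalPartition.sub_nonneg (P : IntervalPartition a b) (k : ℕ) :
    0 ≤ (P.seq (k + 1) : ℝ) - P.seq k :=
  _root_.sub_nonneg.2 (P.seq_monotone k.le_succ)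

lemma IntervalPartition.mesh_nonneg (P : IntervalPartition a b) : 0 ≤ P.mesh :=
  Real.iSup_nonneg fun k => _root_.sub_nonneg.2 (P.strictMono.monotone k.castSucc_le_succ)

lemma IntervalPartition.sum_sub (P : IntervalPartition a b) :
    ∑ k ∈ Finset.range P.n, ((P.seq (k + 1) : ℝ) - P.seq k) = b - a := by
  rw [Finset.sum_range_sub (fun k => (P.seq k : ℝ)), P.seq_n, P.seq_zero]

lemma tendsto_mesh (a b : ℝ) : Tendsto IntervalPartition.mesh (meshFilter a b) (𝓝 0) :=
  tendsto_comap

instance : (meshFilter a b).IsCountablyGenerated := by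
  unfold meshFilter
  infer_instance

/-- The partition of `[a, b]` into `m + 1` intervals of equal length. -/
noncomputable def uniformPartition (hab : a < b) (m : ℕ) : IntervalPartition a b where
  n := m + 1
  pt k := ⟨a + k * ((b - a) / (m + 1)), by
    have h1 : (0 : ℝ) < m + 1 := by positivity
    have h2 : (k : ℝ) ≤ m + 1 := by
      have := k.is_le
      exact_mod_cast this
    have h3 : 0 < b - a := sub_pos.2 hab
    constructor
    · have : 0 ≤ (k : ℝ) * ((b - a) / (m + 1)) := by positivity
      linarith
    · have : (k : ℝ) * ((b - a) / (m + 1)) ≤ (m + 1) * ((b - a) / (m + 1)) := by gcongr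
      rw [mul_div_cancel₀ _ h1.ne'] at this
      linarith⟩
  strictMono := by
    intro i j hij
    have h3 : 0 < (b - a) / ((m : ℝ) + 1) := div_pos (sub_pos.2 hab) (by positivity)
    have h4 : (i : ℝ) < j := by exact_mod_cast hij
    have h5 := mul_lt_mul_of_pos_right h4 h3
    exact Subtype.mk_lt_mk.2 (by linarith)
  first := by simp
  last := by
    have h1 : (m : ℝ) + 1 ≠ 0 := by positivity
    simp [field]

lemma mesh_uniformPartition_le (hab : a < b) (m : ℕ) :
    (uniformPartition hab m).mesh ≤ (b - a) / (m + 1) := by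
  refine Real.iSup_le (fun k => le_of_eq ?_) (div_nonneg (sub_pos.2 hab).le (by positivity))
  change (a + ((k : ℕ) + 1 : ℕ) * ((b - a) / (m + 1))) - (a + (k : ℕ) * ((b - a) / (m + 1))) = _
  push_cast
  ring

lemma tendsto_uniformPartition (hab : a < b) :
    Tendsto (uniformPartition hab) atTop (meshFilter a b) := by
  refine tendsto_comap_iff.2 (squeeze_zero (fun m => IntervalPartition.mesh_nonneg _)
    (mesh_uniformPartition_le hab) ?_)
  have := (tendsto_one_div_add_atTop_nhds_zero_nat (𝕜 := ℝ)).const_mul (b - a)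
  simpa only [mul_one_div, mul_zero] using this

lemma meshFilter_neBot (hab : a < b) : (meshFilter a b).NeBot :=
  (tendsto_uniformPartition hab).neBot

end Partition

/-! ### Young integration -/

section Sewing

variable {a b : ℝ}

/-- The constant `2 / (1 - 2 ^ (1 - θ))` of the sewing estimate. -/
noncomputable def sewingConst (θ : ℝ) : ℝ := 2 / (1 - 2 ^ (1 - θ))

lemma sewingConst_denom_pos {θ : ℝ} (hθ : 1 < θ) : 0 < 1 - (2 : ℝ) ^ (1 - θ) := by
  have : (2 : ℝ) ^ (1 - θ) < 1 := Real.rpow_lt_one_of_one_lt_of_neg one_lt_two (by linarith)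
  linarith

lemma sewingConst_nonneg {θ : ℝ} (hθ : 1 < θ) : 0 ≤ sewingConst θ :=
  div_nonneg zero_le_two (sewingConst_denom_pos hθ).le

/-- Discrete sewing lemma. The sum is cut at the last point of the left half, so that both
remaining parts live on intervals of at most half the length. -/
lemma abs_sum_sub_le_of_almost_additive {A : Set.Icc a b → Set.Icc a b → ℝ} {N θ : ℝ}
    (hN : 0 ≤ N) (hθ : 1 < θ) (hA₀ : ∀ u, A u u = 0)
    (hA : ∀ u m v, u ≤ m → m ≤ v → |A u v - A u m - A m v| ≤ N * ((v : ℝ) - u) ^ θ)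
    (n : ℕ) (t : ℕ → Set.Icc a b) (ht : Monotone t) :
    |∑ k ∈ Finset.range n, A (t k) (t (k + 1)) - A (t 0) (t n)| ≤
      sewingConst θ * N * ((t n : ℝ) - t 0) ^ θ := by
  induction n using Nat.strong_induction_on generalizing t with
  | _ n ih =>
    rcases Nat.eq_zero_or_pos n with rfl | hn
    · simp [hA₀, Real.zero_rpow (by linarith : θ ≠ 0)]
    set T : ℝ := (t n : ℝ) - t 0 with hT
    have hmono : ∀ {i j}, i ≤ j → (t i : ℝ) ≤ t j := fun h => ht h
    have hT0 : 0 ≤ T := sub_nonneg.2 (hmono (Nat.zero_le n))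
    obtain ⟨m, hmn, hm1, hm2⟩ : ∃ m < n, (t m : ℝ) - t 0 ≤ T / 2 ∧
        (t n : ℝ) - t (m + 1) ≤ T / 2 := by
      by_contra! hcon
      have key : ∀ m ≤ n, (t m : ℝ) - t 0 ≤ T / 2 := by
        intro m
        induction m with
        | zero => intro _; simp; positivity
        | succ m ihm =>
          intro hm
          have := hcon m (by omega) (ihm (by omega))
          linarith
      obtain ⟨m, rfl⟩ : ∃ m, n = m + 1 := ⟨n - 1, by omega⟩
      have := hcon m (by omega) (key m (by omega))
      linarith [key (m + 1) le_rfl]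
    have h1 := ih m hmn t ht
    have h2 := ih (n - (m + 1)) (by omega) (fun k => t (m + 1 + k))
      (fun i j hij => ht (by omega))
    have hsum : ∑ k ∈ Finset.range n, A (t k) (t (k + 1)) =
        ∑ k ∈ Finset.range m, A (t k) (t (k + 1)) + A (t m) (t (m + 1)) +
          ∑ k ∈ Finset.range (n - (m + 1)), A (t (m + 1 + k)) (t (m + 1 + (k + 1))) := by
      conv_lhs => rw [show n = (m + 1) + (n - (m + 1)) by omega]
      rw [Finset.sum_range_add, Finset.sum_range_succ]
      simp only [add_assoc]
    simp only [add_zero, show m + 1 + (n - (m + 1)) = n by omega] at h2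
    have h3 := hA (t 0) (t m) (t n) (ht (Nat.zero_le m)) (ht hmn.le)
    have h4 := hA (t m) (t (m + 1)) (t n) (ht m.le_succ) (ht hmn)
    have hK := sewingConst_nonneg hθ
    have hθ0 : 0 ≤ θ := by linarith
    have h4' : ((t n : ℝ) - t m) ^ θ ≤ T ^ θ := by
      refine Real.rpow_le_rpow (sub_nonneg.2 (hmono hmn.le)) ?_ hθ0
      linarith [hmono (Nat.zero_le m)]
    have h1' : ((t m : ℝ) - t 0) ^ θ ≤ (T / 2) ^ θ :=
      Real.rpow_le_rpow (sub_nonneg.2 (hmono (Nat.zero_le m))) hm1 hθ0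
    have h2' : ((t n : ℝ) - t (m + 1)) ^ θ ≤ (T / 2) ^ θ :=
      Real.rpow_le_rpow (sub_nonneg.2 (hmono hmn)) hm2 hθ0
    have hhalf : (T / 2) ^ θ = T ^ θ * (2 ^ (1 - θ) / 2) := by
      rw [Real.div_rpow hT0 zero_le_two, Real.rpow_sub zero_lt_two, Real.rpow_one]
      field_simp
    have hdef : sewingConst θ * 2 ^ (1 - θ) + 2 = sewingConst θ := by
      have := (sewingConst_denom_pos hθ).ne'
      unfold sewingConst
      field_simp
      ring
    have hTθ : 0 ≤ T ^ θ := Real.rpow_nonneg hT0 _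
    have hKN : 0 ≤ sewingConst θ * N := mul_nonneg hK hN
    rw [hsum]
    calc _ ≤ |∑ k ∈ Finset.range m, A (t k) (t (k + 1)) - A (t 0) (t m)| +
          |∑ k ∈ Finset.range (n - (m + 1)), A (t (m + 1 + k)) (t (m + 1 + (k + 1))) -
            A (t (m + 1)) (t n)| + |A (t 0) (t n) - A (t 0) (t m) - A (t m) (t n)| +
          |A (t m) (t n) - A (t m) (t (m + 1)) - A (t (m + 1)) (t n)| := by
            rw [abs_sub_comm (A (t 0) (t n) - A (t 0) (t m)), abs_sub_comm
              (A (t m) (t n) - A (t m) (t (m + 1)))]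
            refine le_trans (le_of_eq ?_) ((abs_add_le _ _).trans (add_le_add
              ((abs_add_le _ _).trans (add_le_add (abs_add_le _ _) le_rfl)) le_rfl))
            congr 1
            ring
      _ ≤ sewingConst θ * N * (T / 2) ^ θ + sewingConst θ * N * (T / 2) ^ θ + N * T ^ θ +
          N * T ^ θ := by
            gcongr
            · exact h1.trans (by gcongr)
            · exact h2.trans (by gcongr)
            · exact h4.trans (by gcongr)
      _ = (sewingConst θ * 2 ^ (1 - θ) + 2) * N * T ^ θ := by rw [hhalf]; ring
      _ = sewingConst θ * N * T ^ θ := by rw [hdef]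

/-- The restriction of the point `y` to the interval `[x, x']`. -/
def clamp (x x' y : Set.Icc a b) : Set.Icc a b := max x (min y x')

lemma clamp_monotone (x x' : Set.Icc a b) : Monotone (clamp x x') := fun _ _ h =>
  max_le_max le_rfl (min_le_min h le_rfl)

/-- The contribution of the intersection of two intervals does not depend on which of them is
cut by the other one. This makes the passage to common refinements symmetric. -/
lemma apply_clamp_comm {A : Set.Icc a b → Set.Icc a b → ℝ} (hA₀ : ∀ u, A u u = 0)
    {x x' y y' : Set.Icc a b} (hx : x ≤ x') (hy : y ≤ y') :
    A (clamp x x' y) (clamp x x' y') = A (clamp y y' x) (clamp y y' x') := by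
  unfold clamp
  rcases lt_or_ge x' y with h | h
  · have h1 : max x (min y x') = x' := by rw [min_eq_right h.le, max_eq_right hx]
    have h2 : max x (min y' x') = x' := by rw [min_eq_right (h.le.trans hy), max_eq_right hx]
    have h3 : max y (min x y') = y := max_eq_left ((min_le_left _ _).trans (hx.trans h.le))
    have h4 : max y (min x' y') = y := max_eq_left ((min_le_left _ _).trans h.le)
    rw [h1, h2, h3, h4, hA₀, hA₀]
  rcases lt_or_ge y' x with h' | h'
  · have h1 : max x (min y x') = x := max_eq_left ((min_le_left _ _).trans (hy.trans h'.le))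
    have h2 : max x (min y' x') = x := max_eq_left ((min_le_left _ _).trans h'.le)
    have h3 : max y (min x y') = y' := by rw [min_eq_right h'.le, max_eq_right hy]
    have h4 : max y (min x' y') = y' := by rw [min_eq_right (h'.le.trans hx), max_eq_right hy]
    rw [h1, h2, h3, h4, hA₀, hA₀]
  rw [min_eq_left h, min_eq_left h', max_comm x y, max_eq_right (le_min h' hx),
    max_eq_right (le_min h hy), min_comm y' x']

/-- Refining a partition by the points of another one changes the Riemann sum little: the sewing
estimate is applied in each cell, and `∑ (x_{k+1} - x_k) ^ θ ≤ (b - a) mesh ^ (θ - 1)`. -/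
lemma abs_sum_sub_sum_clamp_le {A : Set.Icc a b → Set.Icc a b → ℝ} {N θ : ℝ}
    (hN : 0 ≤ N) (hθ : 1 < θ) (hA₀ : ∀ u, A u u = 0)
    (hA : ∀ u m v, u ≤ m → m ≤ v → |A u v - A u m - A m v| ≤ N * ((v : ℝ) - u) ^ θ)
    (P Q : IntervalPartition a b) :
    |∑ i ∈ Finset.range P.n, A (P.seq i) (P.seq (i + 1)) -
      ∑ i ∈ Finset.range P.n, ∑ j ∈ Finset.range Q.n,
        A (clamp (P.seq i) (P.seq (i + 1)) (Q.seq j))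
          (clamp (P.seq i) (P.seq (i + 1)) (Q.seq (j + 1)))| ≤
      sewingConst θ * N * (b - a) * P.mesh ^ (θ - 1) := by
  have hK : 0 ≤ sewingConst θ * N := mul_nonneg (sewingConst_nonneg hθ) hN
  rw [← Finset.sum_sub_distrib]
  calc _ ≤ ∑ i ∈ Finset.range P.n, sewingConst θ * N *
        (((P.seq (i + 1) : ℝ) - P.seq i) * P.mesh ^ (θ - 1)) := by
        refine (Finset.abs_sum_le_sum_abs _ _).trans (Finset.sum_le_sum fun i hi => ?_)
        have h := abs_sum_sub_le_of_almost_additive hN hθ hA₀ hA Q.n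
          (fun j => clamp (P.seq i) (P.seq (i + 1)) (Q.seq j))
          ((clamp_monotone _ _).comp Q.seq_monotone)
        have hi' := P.seq_monotone i.le_succ
        have h0 : clamp (P.seq i) (P.seq (i + 1)) (Q.seq 0) = P.seq i :=
          max_eq_left ((min_le_left _ _).trans (Q.seq_zero_le _))
        have hn : clamp (P.seq i) (P.seq (i + 1)) (Q.seq Q.n) = P.seq (i + 1) := by
          unfold clamp
          rw [min_eq_right (Q.le_seq_n _), max_eq_right hi']
        simp only [h0, hn] at h
        rw [abs_sub_comm]
        refine h.trans (mul_le_mul_of_nonneg_left ?_ hK)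
        have hd := P.sub_nonneg i
        have hm := P.sub_le_mesh (Finset.mem_range.1 hi)
        rcases hd.eq_or_lt with h0' | h0'
        · rw [← h0', Real.zero_rpow (by linarith), zero_mul]
        · conv_lhs => rw [show θ = 1 + (θ - 1) by ring, Real.rpow_add h0', Real.rpow_one]
          exact mul_le_mul_of_nonneg_left (Real.rpow_le_rpow hd hm (by linarith)) hd
    _ = sewingConst θ * N * (b - a) * P.mesh ^ (θ - 1) := by
        rw [← Finset.mul_sum, ← Finset.sum_mul, P.sum_sub]
        ring

end Sewing

section Young

variable {a b : ℝ} {f g : Set.Icc a b → ℝ} {Cf Cg δ γ : ℝ≥0}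

lemma _root_.HolderWith.abs_sub_le {C r : ℝ≥0} (hf : HolderWith C r f) {x y : Set.Icc a b}
    (hxy : x ≤ y) : |f y - f x| ≤ C * ((y : ℝ) - x) ^ (r : ℝ) := by
  have h := hf.dist_le y x
  rwa [Real.dist_eq, Subtype.dist_eq, Real.dist_eq,
    abs_of_nonneg (sub_nonneg.2 (Subtype.coe_le_coe.2 hxy))] at h

/-- The germ `f(u) (g(v) - g(u))` of the Young integral is almost additive. -/
lemma abs_germ_sub_le (hf : HolderWith Cf δ f) (hg : HolderWith Cg γ g) (u m v : Set.Icc a b)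
    (hum : u ≤ m) (hmv : m ≤ v) :
    |f u * (g v - g u) - f u * (g m - g u) - f m * (g v - g m)| ≤
      (Cf * Cg : ℝ) * ((v : ℝ) - u) ^ ((δ : ℝ) + γ) := by
  have hum' : (u : ℝ) ≤ m := hum
  have hmv' : (m : ℝ) ≤ v := hmv
  rw [show f u * (g v - g u) - f u * (g m - g u) - f m * (g v - g m) =
    -((f m - f u) * (g v - g m)) by ring, abs_neg, abs_mul]
  have h1 : |f m - f u| ≤ Cf * ((v : ℝ) - u) ^ (δ : ℝ) := (hf.abs_sub_le hum).trans <|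
    mul_le_mul_of_nonneg_left (Real.rpow_le_rpow (by linarith) (by linarith) δ.2) Cf.2
  have h2 : |g v - g m| ≤ Cg * ((v : ℝ) - u) ^ (γ : ℝ) := (hg.abs_sub_le hmv).trans <|
    mul_le_mul_of_nonneg_left (Real.rpow_le_rpow (by linarith) (by linarith) γ.2) Cg.2
  rw [Real.rpow_add_of_nonneg (by linarith) δ.coe_nonneg γ.coe_nonneg]
  calc _ ≤ (Cf * ((v : ℝ) - u) ^ (δ : ℝ)) * (Cg * ((v : ℝ) - u) ^ (γ : ℝ)) :=
        mul_le_mul h1 h2 (abs_nonneg _) ((abs_nonneg _).trans h1)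
    _ = _ := by ring

lemma abs_leftSum_sub_leftSum_le (hδγ : 1 < (δ : ℝ) + γ) (hf : HolderWith Cf δ f)
    (hg : HolderWith Cg γ g) (P Q : IntervalPartition a b) :
    |leftSum P f g - leftSum Q f g| ≤ sewingConst (δ + γ) * (Cf * Cg) * (b - a) *
      (P.mesh ^ ((δ : ℝ) + γ - 1) + Q.mesh ^ ((δ : ℝ) + γ - 1)) := by
  set A : Set.Icc a b → Set.Icc a b → ℝ := fun u v => f u * (g v - g u) with hAdef
  have hA₀ : ∀ u, A u u = 0 := fun u => by simp [hAdef]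
  have hN : (0 : ℝ) ≤ Cf * Cg := by positivity
  have h1 := abs_sum_sub_sum_clamp_le hN hδγ hA₀ (abs_germ_sub_le hf hg) P Q
  have h2 := abs_sum_sub_sum_clamp_le hN hδγ hA₀ (abs_germ_sub_le hf hg) Q P
  have h3 : ∑ i ∈ Finset.range P.n, ∑ j ∈ Finset.range Q.n,
        A (clamp (P.seq i) (P.seq (i + 1)) (Q.seq j))
          (clamp (P.seq i) (P.seq (i + 1)) (Q.seq (j + 1))) =
      ∑ j ∈ Finset.range Q.n, ∑ i ∈ Finset.range P.n,
        A (clamp (Q.seq j) (Q.seq (j + 1)) (P.seq i))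
          (clamp (Q.seq j) (Q.seq (j + 1)) (P.seq (i + 1))) := by
    rw [Finset.sum_comm]
    exact Finset.sum_congr rfl fun j _ => Finset.sum_congr rfl fun i _ =>
      apply_clamp_comm hA₀ (P.seq_monotone i.le_succ) (Q.seq_monotone j.le_succ)
  rw [h3] at h1
  rw [leftSum_eq_sum_range, leftSum_eq_sum_range, mul_add]
  rw [abs_sub_comm] at h2
  exact (abs_sub_le _ _ _).trans (add_le_add h1 h2)

/-- **Young's theorem**: the left-point Riemann sums converge if the Hölder exponents of the
integrand and of the integrator add up to more than one. -/
theorem exists_hasYoungIntegral (hab : a < b) (hδγ : 1 < (δ : ℝ) + γ) (hf : MemHolder δ f)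
    (hg : MemHolder γ g) : ∃ I, HasYoungIntegral f g I := by
  obtain ⟨Cf, hf⟩ := hf
  obtain ⟨Cg, hg⟩ := hg
  have := meshFilter_neBot hab
  suffices h : Cauchy (map (fun P => leftSum P f g) (meshFilter a b)) from
    CompleteSpace.complete h
  refine cauchy_map_iff.2 ⟨this, tendsto_uniformity_iff_dist_tendsto_zero.2 ?_⟩
  have hm : Tendsto (fun P : IntervalPartition a b => P.mesh ^ ((δ : ℝ) + γ - 1))
      (meshFilter a b) (𝓝 0) := by
    have := (tendsto_mesh a b).rpow_const (p := (δ : ℝ) + γ - 1) (Or.inr (by linarith))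
    rwa [Real.zero_rpow (by linarith)] at this
  have hlim := ((hm.comp tendsto_fst).add (hm.comp tendsto_snd)).const_mul
    (sewingConst (δ + γ) * (Cf * Cg) * (b - a))
  rw [add_zero, mul_zero] at hlim
  exact squeeze_zero (fun _ => dist_nonneg)
    (fun p => (abs_leftSum_sub_leftSum_le hδγ hf hg p.1 p.2 : _)) hlim

lemma hasYoungIntegral_youngIntegral (hab : a < b) (hδγ : 1 < (δ : ℝ) + γ) (hf : MemHolder δ f)
    (hg : MemHolder γ g) : HasYoungIntegral f g (youngIntegral f g) :=
  tendsto_nhds_limUnder (exists_hasYoungIntegral hab hδγ hf hg)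

/-- The Young–Loève bound. -/
lemma abs_youngIntegral_le (hab : a < b) (hδγ : 1 < (δ : ℝ) + γ) (hf : HolderWith Cf δ f)
    (hg : HolderWith Cg γ g) {M : ℝ} (hM : ∀ x, |f x| ≤ M) :
    |youngIntegral f g| ≤ M * (Cg * (b - a) ^ (γ : ℝ)) +
      sewingConst (δ + γ) * (Cf * Cg) * (b - a) ^ ((δ : ℝ) + γ) := by
  have := meshFilter_neBot hab
  refine le_of_tendsto (hasYoungIntegral_youngIntegral hab hδγ ⟨Cf, hf⟩ ⟨Cg, hg⟩).abs
    (Eventually.of_forall fun P => ?_)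
  have h := abs_sum_sub_le_of_almost_additive (A := fun u v => f u * (g v - g u))
    (by positivity : (0 : ℝ) ≤ Cf * Cg) hδγ (fun u => by simp) (abs_germ_sub_le hf hg) P.n P.seq
    P.seq_monotone
  simp only [P.seq_n, P.seq_zero] at h
  rw [← leftSum_eq_sum_range] at h
  have h2 : |f (P.seq 0) * (g (P.seq P.n) - g (P.seq 0))| ≤ M * (Cg * (b - a) ^ (γ : ℝ)) := by
    have h3 := hg.abs_sub_le (P.seq_zero_le (P.seq P.n))
    rw [P.seq_n, P.seq_zero] at h3
    rw [abs_mul]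
    exact mul_le_mul (hM _) h3 (abs_nonneg _) ((abs_nonneg _).trans (hM (P.seq 0)))
  have h4 := abs_sub_abs_le_abs_sub (leftSum P f g) (f (P.seq 0) * (g (P.seq P.n) - g (P.seq 0)))
  linarith

end Young

end OrderFlow

/-! ### The σ-field on Hölder paths -/

/-- The Borel σ-field of `C(K, ℝ)` is generated by the evaluations. -/
lemma ContinuousMap.measurable_of_measurable_eval {K Ω : Type*} [TopologicalSpace K]
    [CompactSpace K] [T2Space K] [SecondCountableTopology K] [MeasurableSpace Ω]
    {f : Ω → C(K, ℝ)} (hf : ∀ x, Measurable fun ξ => f ξ x) : Measurable[_, borel C(K, ℝ)] f := by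
  let _ : MeasurableSpace C(K, ℝ) := borel _
  have _ : BorelSpace C(K, ℝ) := ⟨rfl⟩
  -- In a separable metric space, it suffices to consider closed balls, which are countable
  -- intersections of conditions on the values at a dense sequence of points.
  have hball : ∀ (g : C(K, ℝ)) (r : ℝ), 0 ≤ r → MeasurableSet (f ⁻¹' Metric.closedBall g r) := by
    intro g r hr
    obtain ⟨D, hDc, hDd⟩ := TopologicalSpace.exists_countable_dense K
    have : f ⁻¹' Metric.closedBall g r = ⋂ x ∈ D, {ξ | dist (f ξ x) (g x) ≤ r} := by
      ext ξ
      simp only [Set.mem_preimage, Metric.mem_closedBall, Set.mem_iInter, Set.mem_ofPred_eq]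
      rw [ContinuousMap.dist_le hr]
      refine ⟨fun h x _ => h x, fun h x => ?_⟩
      have hcl : IsClosed {x | dist (f ξ x) (g x) ≤ r} :=
        isClosed_le (by fun_prop) continuous_const
      exact (hcl.closure_subset_iff.2 h) (hDd x)
    rw [this]
    exact MeasurableSet.biInter hDc fun x _ =>
      measurableSet_le ((hf x).dist measurable_const) measurable_const
  refine measurable_of_isOpen fun U hU => ?_
  have hr : ∀ g : U, ∃ r > 0, Metric.closedBall (g : C(K, ℝ)) r ⊆ U := fun g =>
    Metric.nhds_basis_closedBall.mem_iff.1 (hU.mem_nhds g.2)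
  choose r hr0 hrU using hr
  obtain ⟨T, hTc, hT⟩ := TopologicalSpace.isOpen_iUnion_countable
    (fun g : U => Metric.ball (g : C(K, ℝ)) (r g)) fun _ => Metric.isOpen_ball
  have hUT : U = ⋃ g ∈ T, Metric.closedBall (g : C(K, ℝ)) (r g) := by
    apply Set.Subset.antisymm
    · intro g hg
      have : g ∈ ⋃ g : U, Metric.ball (g : C(K, ℝ)) (r g) :=
        Set.mem_iUnion.2 ⟨⟨g, hg⟩, Metric.mem_ball_self (hr0 _)⟩
      rw [← hT] at this
      exact Set.iUnion₂_mono (fun _ _ => Metric.ball_subset_closedBall) this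
    · exact Set.iUnion₂_subset fun g _ => hrU g
  rw [hUT, Set.preimage_iUnion₂]
  exact MeasurableSet.biUnion hTc fun g _ => hball g _ (hr0 g).le

namespace OrderFlow

section Path

variable {a b : ℝ} {γ : ℝ≥0} {Ω : Type*} [MeasurableSpace Ω]

lemma HolderPath.measurable_eval (x : Set.Icc a b) :
    Measurable fun ω : HolderPath a b γ => ω x := by
  let _ : MeasurableSpace C(Set.Icc a b, ℝ) := borel _
  have _ : BorelSpace C(Set.Icc a b, ℝ) := ⟨rfl⟩
  have h1 : Measurable fun g : C(Set.Icc a b, ℝ) => g x :=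
    (ContinuousEvalConst.continuous_eval_const x).measurable
  have h2 : Measurable (Subtype.val : HolderPath a b γ → C(Set.Icc a b, ℝ)) :=
    comap_measurable _
  exact h1.comp h2

lemma HolderPath.measurable_of_eval {f : Ω → HolderPath a b γ}
    (hf : ∀ x, Measurable fun ξ => f ξ x) : Measurable f := by
  let _ : MeasurableSpace C(Set.Icc a b, ℝ) := borel _
  exact measurable_comap_iff.2 (ContinuousMap.measurable_of_measurable_eval hf)

lemma HolderPath.measurableSpace_eq_comap :
    (inferInstance : MeasurableSpace (HolderPath a b γ)) =
      MeasurableSpace.comap (fun ω (x : Set.Icc a b) => ω x) inferInstance := by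
  apply le_antisymm
  · have := @HolderPath.measurable_of_eval a b γ (HolderPath a b γ)
      (MeasurableSpace.comap (fun ω (x : Set.Icc a b) => ω x) inferInstance) id
      (fun x => (measurable_pi_apply x).comp (comap_measurable _))
    simpa using this.comap_le
  · exact (measurable_pi_lambda _ fun x => HolderPath.measurable_eval x).comap_le

lemma HolderPath.measure_ext {P Q : Measure (HolderPath a b γ)}
    (h : P.map (fun ω (x : Set.Icc a b) => ω x) = Q.map (fun ω (x : Set.Icc a b) => ω x)) :
    P = Q := by
  have hm : Measurable (fun (ω : HolderPath a b γ) (x : Set.Icc a b) => ω x) :=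
    measurable_pi_lambda _ fun x => HolderPath.measurable_eval x
  ext s hs
  obtain ⟨t, ht, rfl⟩ := HolderPath.measurableSpace_eq_comap.le _ hs
  rw [← Measure.map_apply hm ht, ← Measure.map_apply hm ht, h]

end Path

/-! ### Integrals over initial intervals -/

section Lebesgue

variable {a b : ℝ}

lemma lebesgue_apply (s : Set (Set.Icc a b)) :
    lebesgue a b s = volume (Subtype.val '' s) :=
  comap_subtype_coe_apply measurableSet_Icc _ _

instance : IsFiniteMeasure (lebesgue a b) := by
  refine ⟨?_⟩
  rw [lebesgue_apply]
  exact (measure_mono (Subtype.coe_image_subset _ _)).trans_lt measure_Icc_lt_top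

lemma lebesgue_Ioc (x y : Set.Icc a b) :
    lebesgue a b (Set.Ioc x y) = ENNReal.ofReal ((y : ℝ) - x) := by
  rw [lebesgue_apply, ← Real.volume_Ioc]
  congr 1
  ext z
  constructor
  · rintro ⟨z, hz, rfl⟩
    exact hz
  · intro hz
    exact ⟨⟨z, x.2.1.trans hz.1.le, hz.2.trans y.2.2⟩, hz, rfl⟩

lemma lebesgue_Iic_left (P : IntervalPartition a b) : lebesgue a b (Set.Iic (P.seq 0)) = 0 := by
  rw [lebesgue_apply]
  refine measure_mono_null ?_ (Real.volume_singleton (a := a))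
  rintro _ ⟨z, hz, rfl⟩
  exact le_antisymm ((Subtype.coe_le_coe.2 hz).trans_eq P.seq_zero) z.2.1

lemma setIntegral_Iic_sub {m : Measure (Set.Icc a b)} {v : Set.Icc a b → ℝ} (hv : Integrable v m)
    {x y : Set.Icc a b} (hxy : x ≤ y) :
    ∫ z in Set.Iic y, v z ∂m - ∫ z in Set.Iic x, v z ∂m = ∫ z in Set.Ioc x y, v z ∂m := by
  rw [← Set.Iic_union_Ioc_eq_Iic hxy, setIntegral_union (Set.Iic_disjoint_Ioc le_rfl)
    measurableSet_Ioc hv.integrableOn hv.integrableOn]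
  ring

lemma integrable_of_continuous {m : Measure (Set.Icc a b)} [IsFiniteMeasure m]
    {f : Set.Icc a b → ℝ} (hf : Continuous f) : Integrable f m := by
  obtain ⟨C, hC⟩ := isCompact_univ.exists_bound_of_continuousOn hf.continuousOn
  exact Integrable.of_bound hf.aestronglyMeasurable C (Eventually.of_forall fun x => hC x trivial)

/-- Riemann–Stieltjes sums against the indefinite integral of `v` converge to `∫ f v`. -/
lemma tendsto_leftSum_setIntegral_Iic {m : Measure (Set.Icc a b)} (hm : m ≤ lebesgue a b)
    {f v : Set.Icc a b → ℝ} (hf : Continuous f) (hv : Continuous v) :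
    Tendsto (fun P => leftSum P f (fun y => ∫ z in Set.Iic y, v z ∂m)) (meshFilter a b)
      (𝓝 (∫ z, f z * v z ∂m)) := by
  have : IsFiniteMeasure m := isFiniteMeasure_of_le _ hm
  have hvi : Integrable v m := integrable_of_continuous hv
  have hfvi : Integrable (fun z => f z * v z) m := integrable_of_continuous (hf.mul hv)
  have huc : UniformContinuous f := CompactSpace.uniformContinuous_of_continuous hf
  set K : ℝ := ∫ z, |v z| ∂m with hK
  have hK0 : 0 ≤ K := integral_nonneg fun _ => abs_nonneg _
  rw [Metric.tendsto_nhds]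
  intro ε hε
  obtain ⟨ρ, hρ, hfρ⟩ := Metric.uniformContinuous_iff.1 huc (ε / (K + 1)) (by positivity)
  have hmesh : ∀ᶠ P : IntervalPartition a b in meshFilter a b, P.mesh < ρ :=
    (tendsto_mesh a b).eventually (gt_mem_nhds hρ)
  filter_upwards [hmesh] with P hP
  have htel : ∀ {w : Set.Icc a b → ℝ}, Integrable w m → ∫ z, w z ∂m =
      ∑ k ∈ Finset.range P.n, ∫ z in Set.Ioc (P.seq k) (P.seq (k + 1)), w z ∂m := by
    intro w hw
    rw [← Finset.sum_congr rfl fun k _ => setIntegral_Iic_sub hw (P.seq_monotone k.le_succ),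
      Finset.sum_range_sub (fun k => ∫ z in Set.Iic (P.seq k), w z ∂m),
      show Set.Iic (P.seq P.n) = Set.univ from Set.eq_univ_of_forall P.le_seq_n,
      Measure.restrict_univ,
      Measure.restrict_eq_zero.2 (le_antisymm ((hm _).trans_eq (lebesgue_Iic_left P)) zero_le)]
    simp
  rw [Real.dist_eq, leftSum_eq_sum_range, htel hfvi, ← Finset.sum_sub_distrib]
  calc _ ≤ ∑ k ∈ Finset.range P.n,
        ∫ z in Set.Ioc (P.seq k) (P.seq (k + 1)), ε / (K + 1) * |v z| ∂m := by
        refine (Finset.abs_sum_le_sum_abs _ _).trans (Finset.sum_le_sum fun k hk => ?_)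
        rw [setIntegral_Iic_sub hvi (P.seq_monotone k.le_succ), ← integral_const_mul,
          ← integral_sub (hvi.const_mul _).integrableOn hfvi.integrableOn, ← Real.norm_eq_abs]
        refine norm_integral_le_of_norm_le (hvi.abs.const_mul _).integrableOn ?_
        filter_upwards [ae_restrict_mem measurableSet_Ioc] with z hz
        rw [← sub_mul, norm_mul, Real.norm_eq_abs, Real.norm_eq_abs]
        refine mul_le_mul_of_nonneg_right (le_of_lt ?_) (abs_nonneg _)
        rw [← Real.dist_eq]
        refine hfρ ?_
        have hk' := P.sub_le_mesh (Finset.mem_range.1 hk)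
        have h1 : (P.seq k : ℝ) < z := hz.1
        have h2 : (z : ℝ) ≤ P.seq (k + 1) := hz.2
        rw [Subtype.dist_eq, Real.dist_eq, abs_sub_comm, abs_of_pos (sub_pos.2 h1)]
        linarith
    _ = ε / (K + 1) * K := by
        rw [← htel (hvi.abs.const_mul _), integral_const_mul]
    _ < ε := by
        rw [div_mul_eq_mul_div, div_lt_iff₀ (by positivity)]
        nlinarith

end Lebesgue

section Shift

variable {a b : ℝ} {γ : ℝ≥0}

/-- The indefinite integral of a continuous function is a Hölder path. -/
lemma exists_holderPath_integral (hγ : γ ≤ 1) {w : Set.Icc a b → ℝ} (hw : Continuous w) :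
    ∃ ω : HolderPath a b γ, ∀ x, ω x = ∫ y in Set.Iic x, w y ∂(lebesgue a b) := by
  obtain ⟨C, hC⟩ := isCompact_univ.exists_bound_of_continuousOn hw.continuousOn
  have hi : Integrable w (lebesgue a b) := integrable_of_continuous hw
  have hlip : LipschitzWith C.toNNReal fun x : Set.Icc a b =>
      ∫ y in Set.Iic x, w y ∂(lebesgue a b) := by
    refine LipschitzWith.of_dist_le_mul fun x y => ?_
    wlog hxy : x ≤ y generalizing x y
    · rw [dist_comm, dist_comm x]
      exact this y x (le_of_not_ge hxy)
    have hxy' : (x : ℝ) ≤ y := hxy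
    rw [dist_comm, Real.dist_eq, setIntegral_Iic_sub hi hxy, dist_comm, Subtype.dist_eq,
      Real.dist_eq, abs_of_nonneg (sub_nonneg.2 hxy'), ← Real.norm_eq_abs]
    refine (norm_setIntegral_le_of_norm_le_const (C := C) (measure_lt_top _ _)
      fun z _ => hC z trivial).trans ?_
    rw [measureReal_def, lebesgue_Ioc, ENNReal.toReal_ofReal (sub_nonneg.2 hxy')]
    exact mul_le_mul_of_nonneg_right (Real.le_coe_toNNReal C) (sub_nonneg.2 hxy')
  refine ⟨⟨⟨_, hlip.continuous⟩, fun x hx => ?_, ?_⟩, fun x => rfl⟩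
  · have : lebesgue a b (Set.Iic x) = 0 := by
      rw [lebesgue_apply]
      refine measure_mono_null ?_ (Real.volume_singleton (a := a))
      rintro _ ⟨z, hz, rfl⟩
      exact le_antisymm ((Subtype.coe_le_coe.2 hz).trans_eq hx) z.2.1
    simp [Measure.restrict_eq_zero.2 this]
  · exact ((holderWith_one.2 hlip).memHolder).of_le hγ

end Shift

end OrderFlow

/-! ### Centered Gaussian processes: limits and exponential tilts -/

lemma ContinuousLinearMap.apply_eq_sum_single {ι : Type*} [Fintype ι] [DecidableEq ι]
    (L : (ι → ℝ) →L[ℝ] ℝ) (x : ι → ℝ) : L x = ∑ i, L (Pi.single i 1) * x i := by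
  conv_lhs => rw [pi_eq_sum_univ' x]
  simp [map_sum, mul_comm]

namespace OrderFlow

lemma linear_eq_sum {T Ω : Type*} [DecidableEq T] {X : T → Ω → ℝ} (I : Finset T)
    (L : (I → ℝ) →L[ℝ] ℝ) :
    (fun ω => L (I.restrict (X · ω))) = fun ω => ∑ i : I, L (Pi.single i 1) * X i ω :=
  funext fun _ => L.apply_eq_sum_single _

section Gaussian

variable {T Ω : Type*} [MeasurableSpace Ω] {P : Measure Ω}

/-- `X` is a centered Gaussian process with covariance function `C`. -/
structure IsCenteredGaussian (X : T → Ω → ℝ) (C : T → T → ℝ) (P : Measure Ω) : Prop where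
  gaussian : IsGaussianProcess X P
  integral_eq_zero : ∀ t, ∫ ω, X t ω ∂P = 0
  covariance_eq : ∀ s t, cov[X s, X t; P] = C s t

section Basic

variable {X : T → Ω → ℝ} {C : T → T → ℝ}

lemma IsCenteredGaussian.isProbabilityMeasure (h : IsCenteredGaussian X C P) :
    IsProbabilityMeasure P := h.gaussian.isProbabilityMeasure

lemma IsCenteredGaussian.memLp_two (h : IsCenteredGaussian X C P) (t : T) : MemLp (X t) 2 P :=
  (h.gaussian.hasGaussianLaw_eval t).memLp_two

lemma IsCenteredGaussian.aemeasurable (h : IsCenteredGaussian X C P) (t : T) :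
    AEMeasurable (X t) P := h.gaussian.aemeasurable t

lemma IsCenteredGaussian.hasGaussianLaw_linear (h : IsCenteredGaussian X C P) (I : Finset T)
    (L : (I → ℝ) →L[ℝ] ℝ) : HasGaussianLaw (fun ω => L (I.restrict (X · ω))) P :=
  (h.gaussian.hasGaussianLaw I).map L

lemma IsCenteredGaussian.integral_linear [DecidableEq T] (h : IsCenteredGaussian X C P)
    (I : Finset T) (L : (I → ℝ) →L[ℝ] ℝ) : ∫ ω, L (I.restrict (X · ω)) ∂P = 0 := by
  have := h.isProbabilityMeasure
  rw [linear_eq_sum, integral_finsetSum _ fun (i : I) _ =>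
    ((h.memLp_two i).integrable one_le_two).const_mul _]
  simp [integral_const_mul, h.integral_eq_zero]

lemma IsCenteredGaussian.variance_linear [DecidableEq T] (h : IsCenteredGaussian X C P)
    (I : Finset T) (L : (I → ℝ) →L[ℝ] ℝ) : Var[fun ω => L (I.restrict (X · ω)); P] =
      ∑ i, ∑ j, L (Pi.single i 1) * L (Pi.single j 1) * C i j := by
  have := h.isProbabilityMeasure
  rw [← covariance_self (h.hasGaussianLaw_linear I L).aemeasurable, linear_eq_sum,
    covariance_fun_sum_fun_sum (fun i : I => (h.memLp_two i).const_mul _)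
    (fun i : I => (h.memLp_two i).const_mul _)]
  refine Finset.sum_congr rfl fun i _ => Finset.sum_congr rfl fun j _ => ?_
  rw [covariance_const_mul_left, covariance_const_mul_right, h.covariance_eq, mul_assoc]

end Basic

/-- Almost sure limits of centered Gaussian variables are Gaussian. -/
lemma map_eq_gaussianReal_of_tendsto_ae {Z : ℕ → Ω → ℝ} {Z' : Ω → ℝ} {v : ℝ}
    (hG : ∀ n, HasGaussianLaw (Z n) P) (h0 : ∀ n, ∫ ω, Z n ω ∂P = 0)
    (hv : Tendsto (fun n => Var[Z n; P]) atTop (𝓝 v))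
    (hZ : ∀ᵐ ω ∂P, Tendsto (fun n => Z n ω) atTop (𝓝 (Z' ω))) :
    P.map Z' = gaussianReal 0 v.toNNReal := by
  have := (hG 0).isProbabilityMeasure
  have hZ'm : AEMeasurable Z' P := aemeasurable_of_tendsto_metrizable_ae _
    (fun n => (hG n).aemeasurable) hZ
  have : IsProbabilityMeasure (P.map Z') := Measure.isProbabilityMeasure_map hZ'm
  refine Measure.ext_of_charFun (funext fun t => ?_)
  have h1 : Tendsto (fun n => charFun (P.map (Z n)) t) atTop (𝓝 (charFun (P.map Z') t)) := by
    have hcont : Continuous fun x : ℝ => Complex.exp (t * x * Complex.I) := by fun_prop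
    simp_rw [charFun_apply_real]
    rw [integral_map hZ'm hcont.aestronglyMeasurable]
    simp_rw [fun n => integral_map (hG n).aemeasurable
      (hcont.aestronglyMeasurable (μ := P.map (Z n)))]
    refine tendsto_integral_of_dominated_convergence (fun _ => 1)
      (fun n => (hcont.measurable.comp_aemeasurable (hG n).aemeasurable).aestronglyMeasurable)
      (integrable_const 1) (fun n => Eventually.of_forall fun ω => ?_) ?_
    · rw [← Complex.ofReal_mul, Complex.norm_exp_ofReal_mul_I]
    · filter_upwards [hZ] with ω hω using (hcont.tendsto _).comp hω
  have h2 : Tendsto (fun n => charFun (P.map (Z n)) t) atTop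
      (𝓝 (charFun (gaussianReal 0 v.toNNReal) t)) := by
    simp_rw [fun n => (hG n).map_eq_gaussianReal, h0, charFun_gaussianReal]
    have hv' := (continuous_real_toNNReal.tendsto v).comp hv
    have hc : Continuous fun r : ℝ≥0 => Complex.exp (t * (0 : ℝ) * Complex.I - r * t ^ 2 / 2) := by
      fun_prop
    exact (hc.tendsto _).comp hv'
  exact tendsto_nhds_unique h1 h2

/-- Finitely many sequences converging in measure converge almost surely along a common
subsequence. -/
lemma exists_subseq_forall_tendsto_ae {X : ℕ → T → Ω → ℝ} {X' : T → Ω → ℝ}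
    (hX : ∀ t, TendstoInMeasure P (fun n => X n t) atTop (X' t)) (I : Finset T) :
    ∃ ns : ℕ → ℕ, Tendsto ns atTop atTop ∧
      ∀ t ∈ I, ∀ᵐ ω ∂P, Tendsto (fun n => X (ns n) t ω) atTop (𝓝 (X' t ω)) := by
  classical
  induction I using Finset.induction_on with
  | empty => exact ⟨id, tendsto_id, by simp⟩
  | insert t I _ ih =>
    obtain ⟨ns, hns, h⟩ := ih
    obtain ⟨ms, hms, h'⟩ := ((hX t).comp hns).exists_seq_tendsto_ae
    refine ⟨ns ∘ ms, hns.comp hms.tendsto_atTop, fun s hs => ?_⟩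
    rcases Finset.mem_insert.1 hs with rfl | hs
    · exact h'
    · filter_upwards [h s hs] with ω hω using hω.comp hms.tendsto_atTop

/-- Limits in measure of centered Gaussian processes with converging covariances are Gaussian. -/
theorem IsCenteredGaussian.of_tendstoInMeasure {X : ℕ → T → Ω → ℝ} {C : ℕ → T → T → ℝ}
    {X' : T → Ω → ℝ} {C' : T → T → ℝ} (h : ∀ n, IsCenteredGaussian (X n) (C n) P)
    (hC : ∀ s t, Tendsto (fun n => C n s t) atTop (𝓝 (C' s t)))
    (hX : ∀ t, TendstoInMeasure P (fun n => X n t) atTop (X' t)) :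
    IsCenteredGaussian X' C' P := by
  classical
  have := (h 0).isProbabilityMeasure
  have hlin : ∀ (I : Finset T) (L : (I → ℝ) →L[ℝ] ℝ),
      P.map (fun ω => L (I.restrict (X' · ω))) = gaussianReal 0
        (∑ i, ∑ j, L (Pi.single i 1) * L (Pi.single j 1) * C' i j).toNNReal := by
    intro I L
    obtain ⟨ns, hns, hae⟩ := exists_subseq_forall_tendsto_ae hX I
    refine map_eq_gaussianReal_of_tendsto_ae (Z := fun n ω => L (I.restrict (X (ns n) · ω)))
      (fun n => (h _).hasGaussianLaw_linear I L) (fun n => (h _).integral_linear I L) ?_ ?_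
    · simp_rw [fun n => (h n).variance_linear I L]
      exact tendsto_finsetSum _ fun i _ => tendsto_finsetSum _ fun j _ =>
        ((hC i j).comp hns).const_mul _
    · have := (ae_all_iff (ι := I)).2 fun t => hae t t.2
      filter_upwards [this] with ω hω
      exact (L.continuous.tendsto _).comp (tendsto_pi_nhds.2 fun i => hω i)
  have hmeas : ∀ t, AEMeasurable (X' t) P := fun t => by
    obtain ⟨ns, -, hae⟩ := exists_subseq_forall_tendsto_ae hX {t}
    exact aemeasurable_of_tendsto_metrizable_ae _ (fun n => (h _).aemeasurable t)
      (hae t (Finset.mem_singleton_self t))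
  have hgauss : IsGaussianProcess X' P := by
    refine ⟨fun I => ⟨isGaussian_of_map_eq_gaussianReal fun L => ⟨_, _, Eq.trans ?_ (hlin I L)⟩⟩⟩
    have hI : AEMeasurable (fun ω => I.restrict (X' · ω)) P :=
      aemeasurable_pi_lambda _ fun i => hmeas i
    exact AEMeasurable.map_map_of_aemeasurable L.continuous.measurable.aemeasurable hI
  -- The covariances of the limit follow by polarization from the variances of `X' s + X' t`.
  have hpair : ∀ s t, P.map (fun ω => X' s ω + X' t ω) =
      gaussianReal 0 (C' s s + C' s t + C' t s + C' t t).toNNReal := by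
    intro s t
    obtain ⟨ns, hns, hae⟩ := exists_subseq_forall_tendsto_ae hX {s, t}
    refine map_eq_gaussianReal_of_tendsto_ae (Z := fun n ω => X (ns n) s ω + X (ns n) t ω)
      (fun n => (h _).gaussian.hasGaussianLaw_fun_add) (fun n => ?_) ?_ ?_
    · rw [integral_add (((h _).memLp_two s).integrable one_le_two)
        (((h _).memLp_two t).integrable one_le_two), (h _).integral_eq_zero,
        (h _).integral_eq_zero, add_zero]
    · have hvar : ∀ n, Var[fun ω => X n s ω + X n t ω; P] =
          C n s s + C n s t + C n t s + C n t t := by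
        intro n
        have hs := (h n).memLp_two s
        have ht := (h n).memLp_two t
        change Var[X n s + X n t; P] = _
        rw [← covariance_self (hs.add ht).aemeasurable, covariance_add_left hs ht (hs.add ht),
          covariance_add_right hs hs ht, covariance_add_right ht hs ht]
        simp only [(h n).covariance_eq]
        ring
      simp_rw [hvar]
      exact ((((hC s s).comp hns).add ((hC s t).comp hns)).add ((hC t s).comp hns)).add
        ((hC t t).comp hns)
    · filter_upwards [hae s (by simp), hae t (by simp)] with ω h1 h2 using h1.add h2
  have hsingle : ∀ t, P.map (X' t) = gaussianReal 0 (C' t t).toNNReal := by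
    intro t
    obtain ⟨ns, hns, hae⟩ := exists_subseq_forall_tendsto_ae hX {t}
    refine map_eq_gaussianReal_of_tendsto_ae (Z := fun n => X (ns n) t)
      (fun n => (h _).gaussian.hasGaussianLaw_eval t)
      (fun n => (h _).integral_eq_zero t) ?_ (hae t (by simp))
    have hvar : ∀ n, Var[X n t; P] = C n t t := fun n => by
      rw [← covariance_self ((h n).aemeasurable t), (h n).covariance_eq]
    simp_rw [hvar]
    exact (hC t t).comp hns
  have hvar_of_map : ∀ {Z : Ω → ℝ} {v : ℝ}, AEMeasurable Z P → 0 ≤ v →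
      P.map Z = gaussianReal 0 v.toNNReal → Var[Z; P] = v := by
    intro Z v hZ hv hmap
    have := variance_map (X := id) (Y := Z) (μ := P) aemeasurable_id hZ
    rw [hmap, variance_id_gaussianReal, Real.coe_toNNReal _ hv] at this
    exact this.symm
  have hCsymm : ∀ s t, C' s t = C' t s := fun s t => by
    refine tendsto_nhds_unique (hC s t) ((hC t s).congr fun n => ?_)
    rw [← (h n).covariance_eq, ← (h n).covariance_eq, covariance_comm]
  have hCnn : ∀ t, 0 ≤ C' t t := fun t => ge_of_tendsto' (hC t t) fun n => by
    rw [← (h n).covariance_eq, covariance_self ((h n).aemeasurable t)]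
    exact variance_nonneg _ _
  have hCnn2 : ∀ s t, 0 ≤ C' s s + C' s t + C' t s + C' t t := fun s t =>
    ge_of_tendsto' ((((hC s s).add (hC s t)).add (hC t s)).add (hC t t)) fun n => by
      have hs := (h n).memLp_two s
      have ht := (h n).memLp_two t
      have : 0 ≤ cov[X n s + X n t, X n s + X n t; P] := by
        rw [covariance_self (hs.add ht).aemeasurable]
        exact variance_nonneg _ _
      rw [covariance_add_left hs ht (hs.add ht), covariance_add_right hs hs ht,
        covariance_add_right ht hs ht] at this
      simp only [(h n).covariance_eq] at this
      linarith
  have hL2 : ∀ t, MemLp (X' t) 2 P := fun t => (hgauss.hasGaussianLaw_eval t).memLp_two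
  refine ⟨hgauss, fun t => ?_, fun s t => ?_⟩
  · have := integral_map (hmeas t) (f := id) (μ := P) aestronglyMeasurable_id
    simp only [hsingle t, id, integral_id_gaussianReal] at this
    exact this.symm
  · have h1 := hvar_of_map (hmeas s) (hCnn s) (hsingle s)
    have h2 := hvar_of_map (hmeas t) (hCnn t) (hsingle t)
    have h3 := hvar_of_map ((hmeas s).add (hmeas t)) (hCnn2 s t) (hpair s t)
    rw [← covariance_self (hmeas s)] at h1
    rw [← covariance_self (hmeas t)] at h2
    rw [← covariance_self ((hmeas s).add (hmeas t)),
      covariance_add_left (hL2 s) (hL2 t) ((hL2 s).add (hL2 t)),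
      covariance_add_right (hL2 s) (hL2 s) (hL2 t),
      covariance_add_right (hL2 t) (hL2 s) (hL2 t), covariance_comm (X' t) (X' s)] at h3
    linarith [hCsymm s t]

/-- The mixed characteristic/moment generating function of a centered Gaussian pair `(G, R)`.
Write `G = α R + G'` with `G'` uncorrelated with, hence independent of, `R`. -/
lemma integral_cexp_gaussian_pair {G R : Ω → ℝ} (h : HasGaussianLaw (fun ω => (G ω, R ω)) P)
    (hG : ∫ ω, G ω ∂P = 0) (hR : ∫ ω, R ω ∂P = 0) :
    ∫ ω, Complex.exp (G ω * Complex.I + R ω) ∂P =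
      Complex.exp ((Var[R; P] - Var[G; P] : ℝ) / 2 + cov[G, R; P] * Complex.I) := by
  have := h.isProbabilityMeasure
  have hG2 := h.fst.memLp_two
  have hR2 := h.snd.memLp_two
  obtain ⟨α, hα⟩ : ∃ α : ℝ, cov[G, R; P] = α * Var[R; P] := by
    by_cases hD : Var[R; P] = 0
    · refine ⟨0, ?_⟩
      have hR0 : R =ᵐ[P] fun _ => ∫ ω, R ω ∂P := ae_eq_integral_of_variance_eq_zero hR2 hD
      rw [zero_mul, covariance]
      refine integral_eq_zero_of_ae ?_
      filter_upwards [hR0] with ω hω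
      simp [hω]
    · exact ⟨cov[G, R; P] / Var[R; P], by field_simp⟩
  set G' : Ω → ℝ := fun ω => G ω - α * R ω with hG'
  have hpair : HasGaussianLaw (fun ω => (G' ω, R ω)) P :=
    h.map_fun (((ContinuousLinearMap.fst ℝ ℝ ℝ) - α • (ContinuousLinearMap.snd ℝ ℝ ℝ)).prod
      (ContinuousLinearMap.snd ℝ ℝ ℝ))
  have hcov : cov[G', R; P] = 0 := by
    rw [hG', covariance_fun_sub_left hG2 (hR2.const_mul α) hR2, covariance_const_mul_left,
      covariance_self h.snd.aemeasurable, hα, sub_self]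
  have hind : IndepFun G' R P := hpair.indepFun_of_covariance_eq_zero hcov
  have hvar : Var[G'; P] = Var[G; P] - α ^ 2 * Var[R; P] := by
    rw [← covariance_self hpair.fst.aemeasurable]
    conv_lhs => rw [hG']
    rw [covariance_fun_sub_right hpair.fst.memLp_two hG2 (hR2.const_mul α),
      covariance_const_mul_right, hcov, mul_zero, sub_zero, hG',
      covariance_fun_sub_left hG2 (hR2.const_mul α) hG2, covariance_const_mul_left,
      covariance_comm R G, hα, covariance_self h.fst.aemeasurable]
    ring
  have hmean : ∫ ω, G' ω ∂P = 0 := by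
    rw [hG', integral_sub (hG2.integrable one_le_two)
      ((hR2.integrable one_le_two).const_mul α), integral_const_mul, hG, hR]
    simp
  have h1 := complexMGF_gaussianReal hpair.fst.map_eq_gaussianReal Complex.I
  have h2 := complexMGF_gaussianReal h.snd.map_eq_gaussianReal (1 + α * Complex.I)
  rw [hmean, Real.coe_toNNReal _ (variance_nonneg _ _), hvar] at h1
  rw [hR, Real.coe_toNNReal _ (variance_nonneg _ _)] at h2
  have hsplit : ∀ ω, Complex.exp (G ω * Complex.I + R ω) =
      Complex.exp (Complex.I * G' ω) * Complex.exp ((1 + α * Complex.I) * R ω) := by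
    intro ω
    rw [← Complex.exp_add]
    congr 1
    rw [hG']
    push_cast
    ring
  simp_rw [hsplit]
  rw [hind.integral_fun_comp_mul_comp (f := fun x : ℝ => Complex.exp (Complex.I * x))
    (g := fun x : ℝ => Complex.exp ((1 + α * Complex.I) * x)) hpair.fst.aemeasurable
    h.snd.aemeasurable (by fun_prop) (by fun_prop)]
  change complexMGF G' P Complex.I * complexMGF R P (1 + α * Complex.I) = _
  rw [h1, h2, ← Complex.exp_add, hα]
  congr 1
  push_cast
  linear_combination (((Var[G; P] : ℂ) - α ^ 2 * Var[R; P]) / 2 + α ^ 2 * Var[R; P] / 2) *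
    Complex.I_sq

/-- **Cameron–Martin formula**: tilting the law of a Gaussian process by the exponential of a
jointly Gaussian variable `R` amounts to shifting each coordinate by its covariance with `R`. The
process and `R` are indexed together by `Option T`, with `R` at `none`; the finite-dimensional laws
are compared through their characteristic functions. -/
theorem map_withDensity_exp_eq_map_add {Z : Option T → Ω → ℝ} {C : Option T → Option T → ℝ}
    (h : IsCenteredGaussian Z C P) (hZm : ∀ t, Measurable (Z t)) :
    (P.withDensity fun ω => ENNReal.ofReal (Real.exp (Z none ω - 1 / 2 * C none none))).map
        (fun ω t => Z (some t) ω) =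
      P.map (fun ω t => Z (some t) ω + C (some t) none) := by
  classical
  have := h.isProbabilityMeasure
  set R := Z none with hRdef
  set D := C none none with hDdef
  have hRG := h.gaussian.hasGaussianLaw_eval none
  have hVarR : Var[R; P] = D := by
    rw [← covariance_self (h.aemeasurable none), h.covariance_eq]
  have hDm : Measurable fun ω => ENNReal.ofReal (Real.exp (R ω - 1 / 2 * D)) := by
    have := hZm none
    fun_prop
  have hint : Integrable (fun ω => Real.exp (R ω - 1 / 2 * D)) P := by
    have h1 := integrable_exp_mul_gaussianReal (μ := P[R]) (v := Var[R; P].toNNReal) 1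
    rw [← hRG.map_eq_gaussianReal] at h1
    have h2 := (h1.comp_aemeasurable (h.aemeasurable none)).mul_const (Real.exp (-(1 / 2 * D)))
    refine h2.congr (Eventually.of_forall fun ω => ?_)
    simp [sub_eq_add_neg, Real.exp_add, hRdef]
  have := isFiniteMeasure_withDensity_ofReal hint.2
  set P' := P.withDensity fun ω => ENNReal.ofReal (Real.exp (R ω - 1 / 2 * D)) with hP'
  have hXm : Measurable fun ω t => Z (some t) ω := measurable_pi_lambda _ fun t => hZm _
  have hX'm : Measurable fun ω t => Z (some t) ω + C (some t) none :=
    measurable_pi_lambda _ fun t => (hZm _).add_const _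
  have hp1 := isProjectiveLimit_map (P := P') (X := fun t => Z (some t)) hXm.aemeasurable
  have hp2 := isProjectiveLimit_map (P := P) (X := fun t ω => Z (some t) ω + C (some t) none)
    hX'm.aemeasurable
  refine hp1.unique (P := fun I => P'.map (fun ω => I.restrict (fun t => Z (some t) ω))) ?_
  convert hp2 using 2 with I
  have hIm : Measurable fun ω => I.restrict fun t => Z (some t) ω :=
    measurable_pi_lambda _ fun t => hZm _
  have hIm' : Measurable fun ω => I.restrict fun t => Z (some t) ω + C (some t) none :=
    measurable_pi_lambda _ fun t => (hZm _).add_const _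
  refine Measure.ext_of_charFunDual (funext fun L => ?_)
  have hcont : Continuous fun x : I → ℝ => Complex.exp (L x * Complex.I) := by fun_prop
  rw [charFunDual_apply, charFunDual_apply, integral_map hIm.aemeasurable
    hcont.aestronglyMeasurable, integral_map hIm'.aemeasurable hcont.aestronglyMeasurable, hP',
    integral_withDensity_eq_integral_toReal_smul hDm (by simp)]
  set G : Ω → ℝ := fun ω => L (I.restrict fun t => Z (some t) ω) with hGdef
  have hproc : IsCenteredGaussian (fun t => Z (some t)) (fun s t => C (some s) (some t)) P :=
    ⟨h.gaussian.comp_right some, fun t => h.integral_eq_zero _,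
      fun s t => h.covariance_eq _ _⟩
  have hGlin : G = fun ω => ∑ i, L (Pi.single i 1) * Z (some i) ω :=
    funext fun ω => L.apply_eq_sum_single _
  have hpair : HasGaussianLaw (fun ω => (G ω, R ω)) P := by
    let J : Finset (Option T) := insert none (I.image some)
    let L' : (J → ℝ) →L[ℝ] ℝ × ℝ :=
      (∑ i : I, L (Pi.single i 1) • ContinuousLinearMap.proj (R := ℝ) (φ := fun _ : J => ℝ)
        ⟨some i, Finset.mem_insert_of_mem (Finset.mem_image_of_mem _ i.2)⟩).prod
        (ContinuousLinearMap.proj (R := ℝ) (φ := fun _ : J => ℝ)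
          ⟨none, Finset.mem_insert_self _ _⟩)
    have := (h.gaussian.hasGaussianLaw J).map_fun L'
    have he : (fun ω => (G ω, R ω)) = fun ω => L' (J.restrict (Z · ω)) := by
      ext ω
      · rw [hGlin]
        simp [L']
      · simp [L', hRdef]
    rwa [he]
  have hcov : cov[G, R; P] = L (I.restrict fun t => C (some t) none) := by
    rw [hGlin, covariance_fun_sum_left (fun i => (h.memLp_two _).const_mul _) (h.memLp_two none),
      L.apply_eq_sum_single]
    refine Finset.sum_congr rfl fun i _ => ?_
    rw [covariance_const_mul_left, h.covariance_eq]
    rfl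
  have hkey := integral_cexp_gaussian_pair hpair (hproc.integral_linear I L)
    (h.integral_eq_zero none)
  have hkey0 : ∫ ω, Complex.exp (G ω * Complex.I) ∂P = Complex.exp (-(Var[G; P] : ℂ) / 2) := by
    have h1 := complexMGF_gaussianReal (hproc.hasGaussianLaw_linear I L).map_eq_gaussianReal
      Complex.I
    rw [hproc.integral_linear I L, Real.coe_toNNReal _ (variance_nonneg _ _)] at h1
    have h2 : (fun ω => Complex.exp (G ω * Complex.I)) =
        fun ω => Complex.exp (Complex.I * G ω) := by simp_rw [mul_comm]
    rw [h2]
    refine h1.trans ?_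
    simp [hGdef]
  have hlhs : ∀ ω, (ENNReal.ofReal (Real.exp (R ω - 1 / 2 * D))).toReal •
      Complex.exp (L (I.restrict fun t => Z (some t) ω) * Complex.I) =
      Complex.exp (-(D : ℂ) / 2) * Complex.exp (G ω * Complex.I + R ω) := by
    intro ω
    rw [ENNReal.toReal_ofReal (Real.exp_nonneg _), Complex.real_smul, Complex.ofReal_exp,
      ← Complex.exp_add, ← Complex.exp_add]
    congr 1
    push_cast
    ring
  have hrhs : ∀ ω, Complex.exp (L (I.restrict fun t => Z (some t) ω + C (some t) none) *
      Complex.I) = Complex.exp (cov[G, R; P] * Complex.I) * Complex.exp (G ω * Complex.I) := by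
    intro ω
    rw [← Complex.exp_add, hcov]
    congr 1
    have : (I.restrict fun t => Z (some t) ω + C (some t) none) =
        (I.restrict fun t => Z (some t) ω) + I.restrict fun t => C (some t) none := rfl
    rw [this, map_add]
    push_cast
    ring
  simp_rw [hlhs, hrhs]
  rw [integral_const_mul, integral_const_mul, hkey, hkey0, ← Complex.exp_add, ← Complex.exp_add,
    hVarR]
  congr 1
  push_cast
  ring

end Gaussian

end OrderFlow

/-! ### Covariances of Riemann sums -/

namespace OrderFlow

section Gaussian

variable {T Ω : Type*} [MeasurableSpace Ω] {P : Measure Ω}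

/-- Finite linear combinations of a Gaussian process form a Gaussian process. -/
lemma _root_.ProbabilityTheory.IsGaussianProcess.of_eq_sum {S : Type*} {X : T → Ω → ℝ}
    {Y : S → Ω → ℝ} (hX : IsGaussianProcess X P)
    (h : ∀ s, ∃ (κ : Type) (_ : Fintype κ) (c : κ → ℝ) (t : κ → T),
      ∀ ω, Y s ω = ∑ k, c k * X (t k) ω) : IsGaussianProcess Y P := by
  classical
  refine hX.of_isGaussianProcess fun s => ?_
  obtain ⟨κ, _, c, t, hY⟩ := h s
  refine ⟨Finset.univ.image t, ∑ k, c k • ContinuousLinearMap.proj (R := ℝ)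
    (φ := fun _ : (Finset.univ.image t) => ℝ)
    ⟨t k, Finset.mem_image_of_mem _ (Finset.mem_univ _)⟩, fun ω => ?_⟩
  simp [hY]

/-- A Riemann sum as a linear combination of values of the integrator. -/
lemma leftSum_eq_sum_sum {a b : ℝ} (p : IntervalPartition a b) (f g : Set.Icc a b → ℝ) :
    leftSum p f g = ∑ k : Fin p.n ⊕ Fin p.n,
      Sum.elim (fun k => f (p.pt k.castSucc)) (fun k => -f (p.pt k.castSucc)) k *
        g (Sum.elim (fun k => p.pt k.succ) (fun k => p.pt k.castSucc) k) := by
  simp only [leftSum, Fintype.sum_sum_type, Sum.elim_inl, Sum.elim_inr, ← Finset.sum_add_distrib]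
  refine Finset.sum_congr rfl fun k _ => ?_
  ring

/-- Pushing forward along `M` the measure under which `X` is a centered Gaussian process. -/
lemma IsCenteredGaussian.map {Ω' : Type*} [MeasurableSpace Ω'] {X : T → Ω' → ℝ} {M : Ω → Ω'}
    {C : T → T → ℝ} (hM : Measurable M) (hX : ∀ t, Measurable (X t))
    (h : IsCenteredGaussian (fun t ω => X t (M ω)) C P) : IsCenteredGaussian X C (P.map M) := by
  refine ⟨⟨fun I => ⟨?_⟩⟩, fun t => ?_, fun s t => ?_⟩
  · have hI : Measurable fun ω => I.restrict (X · ω) := measurable_pi_lambda _ fun i => hX i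
    rw [Measure.map_map hI hM]
    exact (h.gaussian.hasGaussianLaw I).isGaussian_map
  · rw [integral_map hM.aemeasurable (hX t).aestronglyMeasurable]
    exact h.integral_eq_zero t
  · rw [covariance_map (hX s).aestronglyMeasurable (hX t).aestronglyMeasurable hM.aemeasurable]
    exact h.covariance_eq s t

variable {a b : ℝ} {X : Set.Icc a b → Ω → ℝ} {V : Set.Icc a b → ℝ}

lemma IsCenteredGaussian.memLp_leftSum {C : Set.Icc a b → Set.Icc a b → ℝ}
    (h : IsCenteredGaussian X C P) (p : IntervalPartition a b) (f : Set.Icc a b → ℝ)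
    (z : Set.Icc a b) :
    MemLp (fun ω => leftSum p f fun y => X (min y z) ω) 2 P := by
  unfold leftSum
  exact memLp_finsetSum _ fun k _ => (((h.memLp_two _).sub (h.memLp_two _)).const_mul _ : _)

lemma IsCenteredGaussian.covariance_leftSum_left
    (h : IsCenteredGaussian X (fun s t => V (min s t)) P) (p : IntervalPartition a b)
    (f : Set.Icc a b → ℝ) (z x : Set.Icc a b) :
    cov[fun ω => leftSum p f (fun y => X (min y z) ω), X x; P] =
      leftSum p f fun y => V (min y (min z x)) := by
  have := h.isProbabilityMeasure
  have hL : ∀ k : Fin p.n, MemLp (fun ω => f (p.pt k.castSucc) *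
      (X (min (p.pt k.succ) z) ω - X (min (p.pt k.castSucc) z) ω)) 2 P := fun k =>
    ((h.memLp_two _).sub (h.memLp_two _)).const_mul _
  simp only [leftSum]
  rw [covariance_fun_sum_left hL (h.memLp_two x)]
  refine Finset.sum_congr rfl fun k _ => ?_
  rw [covariance_const_mul_left, covariance_fun_sub_left (h.memLp_two _) (h.memLp_two _)
    (h.memLp_two x), h.covariance_eq, h.covariance_eq, min_assoc, min_assoc]

/-- Stopping at `x_{j+1}` instead of `x_j` adds the `j`-th term of the Riemann sum. -/
lemma leftSum_min_succ_sub (p : IntervalPartition a b) (f U : Set.Icc a b → ℝ) (j : Fin p.n) :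
    leftSum p f (fun y => U (min y (p.pt j.succ))) -
      leftSum p f (fun y => U (min y (p.pt j.castSucc))) =
      f (p.pt j.castSucc) * (U (p.pt j.succ) - U (p.pt j.castSucc)) := by
  have hm := p.strictMono.monotone
  simp only [leftSum]
  rw [← Finset.sum_sub_distrib, Finset.sum_eq_single j]
  · have h1 := hm j.castSucc_le_succ
    rw [min_self, min_eq_left h1, min_eq_right h1, min_self]
    ring
  · intro k _ hkj
    rcases lt_or_gt_of_ne hkj with hlt | hlt
    · have h1 : p.pt k.succ ≤ p.pt j.castSucc := hm (Fin.succ_le_castSucc_iff.2 hlt)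
      have h2 := hm k.castSucc_le_succ
      have h3 := hm j.castSucc_le_succ
      rw [min_eq_left (h1.trans h3), min_eq_left (h2.trans (h1.trans h3)), min_eq_left h1,
        min_eq_left (h2.trans h1), sub_self]
    · have h1 : p.pt j.succ ≤ p.pt k.castSucc := hm (Fin.succ_le_castSucc_iff.2 hlt)
      have h2 := hm k.castSucc_le_succ
      have h3 := hm j.castSucc_le_succ
      rw [min_eq_right (h1.trans h2), min_eq_right h1, min_eq_right (h3.trans (h1.trans h2)),
        min_eq_right (h3.trans h1)]
      ring
  · simp

/-- Increments over disjoint intervals are uncorrelated, so only the diagonal terms remain. -/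
lemma IsCenteredGaussian.covariance_leftSum_leftSum
    (h : IsCenteredGaussian X (fun s t => V (min s t)) P) (p : IntervalPartition a b)
    (f g : Set.Icc a b → ℝ) (x y : Set.Icc a b) :
    cov[fun ω => leftSum p f (fun u => X (min u x) ω),
      fun ω => leftSum p g (fun u => X (min u y) ω); P] =
      leftSum p (fun u => f u * g u) fun u => V (min u (min x y)) := by
  have := h.isProbabilityMeasure
  have hf := h.memLp_leftSum p f x
  have hsum : (fun ω => leftSum p g (fun u => X (min u y) ω)) = fun ω => ∑ k : Fin p.n,
      g (p.pt k.castSucc) * (X (min (p.pt k.succ) y) ω - X (min (p.pt k.castSucc) y) ω) := rfl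
  have hL : ∀ k : Fin p.n, MemLp (fun ω => g (p.pt k.castSucc) *
      (X (min (p.pt k.succ) y) ω - X (min (p.pt k.castSucc) y) ω)) 2 P := fun k =>
    ((h.memLp_two _).sub (h.memLp_two _)).const_mul _
  rw [hsum, covariance_fun_sum_right hL hf]
  conv_rhs => simp only [leftSum]
  refine Finset.sum_congr rfl fun j _ => ?_
  rw [covariance_const_mul_right, covariance_fun_sub_right hf (h.memLp_two _) (h.memLp_two _),
    h.covariance_leftSum_left, h.covariance_leftSum_left]
  have hmin : ∀ u v : Set.Icc a b, min u (min x (min v y)) = min (min u v) (min x y) := by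
    intro u v
    rw [min_left_comm x v y, ← min_assoc]
  simp_rw [hmin]
  rw [leftSum_min_succ_sub p f (fun u => V (min u (min x y))) j]
  ring

end Gaussian

section Integrals

variable {a b : ℝ}

lemma setIntegral_Iic_min {m : Measure (Set.Icc a b)} {v : Set.Icc a b → ℝ} (y z : Set.Icc a b) :
    ∫ u in Set.Iic (min y z), v u ∂m = ∫ u in Set.Iic y, v u ∂(m.restrict (Set.Iic z)) := by
  rw [Measure.restrict_restrict measurableSet_Iic, Set.Iic_inter_Iic]

lemma tendsto_leftSum_min {f v : Set.Icc a b → ℝ} (hf : Continuous f) (hv : Continuous v)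
    (z : Set.Icc a b) :
    Tendsto (fun p => leftSum p f fun y => ∫ u in Set.Iic (min y z), v u ∂(lebesgue a b))
      (meshFilter a b) (𝓝 (∫ u in Set.Iic z, f u * v u ∂(lebesgue a b))) := by
  simp_rw [setIntegral_Iic_min]
  exact tendsto_leftSum_setIntegral_Iic Measure.restrict_le_self hf hv

end Integrals

/-! ### The law of the noise -/

section Noise

variable {a b : ℝ} {Ξ : Type*} [MeasurableSpace Ξ] {μ : Measure Ξ} {B : ℝ≥0 → Ξ → ℝ}

lemma isCenteredGaussian_brownian (hB : IsPreBrownianReal B μ) :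
    IsCenteredGaussian (fun (y : Set.Icc a b) ξ => B (Real.toNNReal ((y : ℝ) - a)) ξ)
      (fun x y => ∫ _ in Set.Iic (min x y), (1 : ℝ) ∂(lebesgue a b)) μ := by
  refine ⟨hB.isGaussianProcess.comp_right fun y : Set.Icc a b => Real.toNNReal ((y : ℝ) - a),
    fun t => hB.integral_eval _, fun s t => ?_⟩
  have hvol : ∀ y : Set.Icc a b, lebesgue a b (Set.Iic y) = ENNReal.ofReal ((y : ℝ) - a) := by
    intro y
    rw [lebesgue_apply, ← Real.volume_Icc]
    congr 1
    ext z
    constructor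
    · rintro ⟨z, hz, rfl⟩
      exact ⟨z.2.1, hz⟩
    · intro hz
      exact ⟨⟨z, hz.1, hz.2.trans y.2.2⟩, hz.2, rfl⟩
  rw [hB.covariance_eval, setIntegral_const, measureReal_def, hvol, smul_eq_mul, mul_one,
    ENNReal.toReal_ofReal (sub_nonneg.2 (min s t).2.1)]
  have hmono : Monotone fun y : Set.Icc a b => Real.toNNReal ((y : ℝ) - a) := fun x y hxy =>
    Real.toNNReal_le_toNNReal (sub_le_sub_right (Subtype.coe_le_coe.2 hxy) a)
  rw [← hmono.map_min, Real.coe_toNNReal _ (sub_nonneg.2 (min s t).2.1)]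

/-- The Itô integrals of `σ` form a centered Gaussian process. Only `σ ^ 2` has to be
continuous: the sign of `σ` does not enter the covariances of the Riemann sums. -/
lemma isCenteredGaussian_of_isItoIntegral (hab : a < b) (hB : IsPreBrownianReal B μ)
    {σ : Set.Icc a b → ℝ} (hσ : Continuous fun x => σ x ^ 2) {J : Set.Icc a b → Ξ → ℝ}
    (hJ : ∀ x, IsItoIntegral μ σ B x (J x)) :
    IsCenteredGaussian J (fun x y => ∫ u in Set.Iic (min x y), σ u ^ 2 ∂(lebesgue a b)) μ := by
  have hBG := isCenteredGaussian_brownian (a := a) (b := b) hB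
  have := hBG.isProbabilityMeasure
  refine IsCenteredGaussian.of_tendstoInMeasure (X := fun n x ξ => leftSum (uniformPartition hab n)
      σ (fun y => B (Real.toNNReal ((min y x : Set.Icc a b) - a)) ξ))
    (C := fun n x y => leftSum (uniformPartition hab n) (fun u => σ u * σ u) fun u =>
      ∫ _ in Set.Iic (min u (min x y)), (1 : ℝ) ∂(lebesgue a b))
    (fun n => ⟨?_, fun x => ?_, fun x y => ?_⟩) (fun x y => ?_)
    fun x => (hJ x).comp (tendsto_uniformPartition hab)
  · exact hBG.gaussian.of_eq_sum fun x =>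
      ⟨_, inferInstance, _, fun k => min (Sum.elim _ _ k) x, fun ξ => leftSum_eq_sum_sum _ _ _⟩
  · simp_rw [leftSum_eq_sum_sum]
    rw [integral_finsetSum _ fun k _ => (hB.integrable_eval _).const_mul _]
    simp only [integral_const_mul, hB.integral_eval, mul_zero, Finset.sum_const_zero]
  · exact hBG.covariance_leftSum_leftSum
      (V := fun x => ∫ _ in Set.Iic x, (1 : ℝ) ∂(lebesgue a b)) _ σ σ x y
  · have h := (tendsto_leftSum_min hσ continuous_const (v := fun _ => (1 : ℝ)) (min x y)).comp
      (tendsto_uniformPartition hab)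
    simpa only [mul_one, ← sq, Function.comp_def] using h

/-- A process of Itô integrals against `B` is independent of whatever `B` is independent of. -/
lemma indepFun_of_isItoIntegral (hab : a < b) {S : Type*} [MeasurableSpace S] {sig : Ξ → S}
    (hindep : IndepFun sig (fun ξ t => B t ξ) μ) {σ : Set.Icc a b → ℝ} {J : Set.Icc a b → Ξ → ℝ}
    (hJ : ∀ x, IsItoIntegral μ σ B x (J x)) : IndepFun sig (fun ξ x => J x ξ) μ := by
  have hex : ∀ x, ∃ F : (ℝ≥0 → ℝ) → ℝ, Measurable F ∧ (fun ξ => F (fun t => B t ξ)) =ᵐ[μ] J x := by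
    intro x
    obtain ⟨ns, -, hns⟩ := ((hJ x).comp (tendsto_uniformPartition hab)).exists_seq_tendsto_ae
    refine ⟨fun β => limsup (fun n => leftSum (uniformPartition hab (ns n)) σ
      (fun y => β (Real.toNNReal ((min y x : Set.Icc a b) - a)))) atTop,
      Measurable.limsup fun n => ?_, ?_⟩
    · unfold leftSum
      fun_prop
    · filter_upwards [hns] with ξ hξ using hξ.limsup_eq
  choose F hFm hF using hex
  have h1 : IndepFun sig (fun ξ x => F x (fun t => B t ξ)) μ :=
    hindep.comp measurable_id (measurable_pi_lambda _ hFm)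
  exact IndepFun.process_congr_right (X := fun x ξ => F x fun t => B t ξ) h1 hF

end Noise

/-! ### The Cameron–Martin theorem on path space -/

section CameronMartin

variable {a b : ℝ} {γ δ : ℝ≥0}

lemma measurable_leftSum_holderPath (p : IntervalPartition a b) (h : Set.Icc a b → ℝ) :
    Measurable fun ω : HolderPath a b γ => leftSum p h ω :=
  Finset.measurable_fun_sum _ fun _ _ =>
    ((HolderPath.measurable_eval _).sub (HolderPath.measurable_eval _)).const_mul _

lemma tendsto_leftSum_uniformPartition (hab : a < b) (hδγ : 1 < (δ : ℝ) + γ) {h : Set.Icc a b → ℝ}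
    (hh : MemHolder δ h) (ω : HolderPath a b γ) :
    Tendsto (fun n => leftSum (uniformPartition hab n) h ω) atTop (𝓝 (youngIntegral h ω)) :=
  (hasYoungIntegral_youngIntegral hab hδγ hh ω.2.2).comp (tendsto_uniformPartition hab)

lemma measurable_youngIntegral (hab : a < b) (hδγ : 1 < (δ : ℝ) + γ) {h : Set.Icc a b → ℝ}
    (hh : MemHolder δ h) : Measurable fun ω : HolderPath a b γ => youngIntegral h ω :=
  measurable_of_tendsto_metrizable (fun _ => measurable_leftSum_holderPath _ h)
    (tendsto_pi_nhds.2 fun ω => tendsto_leftSum_uniformPartition hab hδγ hh ω)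

/-- The coordinate process together with the Young integral of a Hölder function against it is
Gaussian, since the Riemann sums converge pathwise. -/
lemma isCenteredGaussian_youngIntegral (hab : a < b) (hδγ : 1 < (δ : ℝ) + γ)
    {h q : Set.Icc a b → ℝ} (hh : MemHolder δ h) (hhc : Continuous h) (hq : Continuous q)
    {P : Measure (HolderPath a b γ)}
    (hP : IsCenteredGaussian (fun x (ω : HolderPath a b γ) => ω x)
      (fun x y => ∫ u in Set.Iic (min x y), q u ∂(lebesgue a b)) P) :
    IsCenteredGaussian (fun (t : Option (Set.Icc a b)) (ω : HolderPath a b γ) =>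
        t.elim (youngIntegral h ω) fun x => ω x)
      (fun (s t : Option (Set.Icc a b)) => s.elim (t.elim (∫ u, h u ^ 2 * q u ∂(lebesgue a b))
          fun x => ∫ u in Set.Iic x, h u * q u ∂(lebesgue a b))
        fun x => t.elim (∫ u in Set.Iic x, h u * q u ∂(lebesgue a b))
          fun y => ∫ u in Set.Iic (min x y), q u ∂(lebesgue a b)) P := by
  have := hP.isProbabilityMeasure
  set V : Set.Icc a b → ℝ := fun x => ∫ u in Set.Iic x, q u ∂(lebesgue a b) with hV
  set e : Set.Icc a b := ⟨b, hab.le, le_rfl⟩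
  have he : ∀ y : Set.Icc a b, min y e = y := fun y => min_eq_left y.2.2
  have hlast : Set.Iic e = Set.univ := Set.eq_univ_of_forall fun y => y.2.2
  have hS : ∀ n, (fun ω : HolderPath a b γ => leftSum (uniformPartition hab n) h ω) = fun ω =>
      leftSum (uniformPartition hab n) h fun y => ω (min y e) := fun _ => by simp_rw [he]
  have hcross : ∀ n x, cov[fun ω : HolderPath a b γ => leftSum (uniformPartition hab n) h ω,
      fun ω => ω x; P] = leftSum (uniformPartition hab n) h fun y => V (min y x) := by
    intro n x
    rw [hS, hP.covariance_leftSum_left (V := V), min_eq_right (show x ≤ e from x.2.2)]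
  have key : ∀ n, IsCenteredGaussian (fun (t : Option (Set.Icc a b)) (ω : HolderPath a b γ) =>
        t.elim (leftSum (uniformPartition hab n) h ω) fun x => ω x)
      (fun (s t : Option (Set.Icc a b)) => s.elim (t.elim
        (leftSum (uniformPartition hab n) (fun u => h u * h u) V)
          fun x => leftSum (uniformPartition hab n) h fun y => V (min y x))
        fun x => t.elim (leftSum (uniformPartition hab n) h fun y => V (min y x))
          fun y => V (min x y)) P := by
    refine fun n => ⟨?_, fun t => ?_, fun s t => ?_⟩
    · refine hP.gaussian.of_eq_sum fun t => ?_
      cases t with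
      | none => exact ⟨_, inferInstance, _, _, fun ω => leftSum_eq_sum_sum _ _ _⟩
      | some x => exact ⟨Unit, inferInstance, fun _ => 1, fun _ => x, fun ω => by simp⟩
    · cases t with
      | none =>
        simp only [Option.elim_none, leftSum_eq_sum_sum]
        rw [integral_finsetSum _ fun k _ =>
          ((hP.memLp_two _).integrable one_le_two).const_mul _]
        simp only [integral_const_mul, hP.integral_eq_zero, mul_zero, Finset.sum_const_zero]
      | some x => exact hP.integral_eq_zero x
    · cases s with
      | none =>
        cases t with
        | none =>
          have h1 := hP.covariance_leftSum_leftSum (V := V) (uniformPartition hab n) h h e e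
          simpa only [he, Option.elim_none] using h1
        | some x => exact hcross n x
      | some x =>
        cases t with
        | none => exact (covariance_comm _ _).trans (hcross n x)
        | some y => exact hP.covariance_eq x y
  refine IsCenteredGaussian.of_tendstoInMeasure key (fun s t => ?_) fun t => ?_
  · cases s with
    | none =>
      cases t with
      | none =>
        have h1 := (tendsto_leftSum_min (f := fun u => h u * h u) (hhc.mul hhc) hq e).comp
          (tendsto_uniformPartition hab)
        rw [hlast, Measure.restrict_univ] at h1
        simp only [Function.comp_def, he] at h1
        simp only [Option.elim_none, sq]
        exact h1
      | some x => exact (tendsto_leftSum_min hhc hq x).comp (tendsto_uniformPartition hab)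
    | some x =>
      cases t with
      | none => exact (tendsto_leftSum_min hhc hq x).comp (tendsto_uniformPartition hab)
      | some y => exact tendsto_const_nhds
  · cases t with
    | none =>
      exact tendstoInMeasure_of_tendsto_ae
        (fun _ => (measurable_leftSum_holderPath _ h).aestronglyMeasurable)
        (Eventually.of_forall fun ω => tendsto_leftSum_uniformPartition hab hδγ hh ω)
    | some x =>
      exact tendstoInMeasure_of_tendsto_ae
        (fun _ => (HolderPath.measurable_eval x).aestronglyMeasurable)
        (Eventually.of_forall fun ω => tendsto_const_nhds)

/-- The law of the noise shifted by the indefinite integral of `w` has an explicit density,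
in which the stochastic integral is a pathwise Young integral. -/
theorem map_shift_eq_withDensity (hab : a < b) (hδγ : 1 < (δ : ℝ) + γ)
    {w q : Set.Icc a b → ℝ} (hw : MemHolder δ fun x => w x / q x)
    (hwc : Continuous fun x => w x / q x) (hq : Continuous q) (hq0 : ∀ x, 0 < q x)
    {P : Measure (HolderPath a b γ)}
    (hP : IsCenteredGaussian (fun x (ω : HolderPath a b γ) => ω x)
      (fun x y => ∫ u in Set.Iic (min x y), q u ∂(lebesgue a b)) P)
    {Φ : HolderPath a b γ → HolderPath a b γ} (hΦm : Measurable Φ)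
    (hΦ : ∀ ω x, Φ ω x = ω x + ∫ u in Set.Iic x, w u ∂(lebesgue a b)) :
    P.map Φ = P.withDensity fun ω => ENNReal.ofReal (Real.exp
      (youngIntegral (fun x => w x / q x) ω -
        1 / 2 * ∫ x, w x ^ 2 / q x ∂(lebesgue a b))) := by
  have h := isCenteredGaussian_youngIntegral hab hδγ hw hwc hq hP
  have hcm := map_withDensity_exp_eq_map_add h fun t => by
    cases t with
    | none => exact measurable_youngIntegral hab hδγ hw
    | some x => exact HolderPath.measurable_eval x
  have h1 : ∀ x, w x / q x * q x = w x := fun x => div_mul_cancel₀ _ (hq0 x).ne'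
  have h2 : ∀ x, (w x / q x) ^ 2 * q x = w x ^ 2 / q x := fun x => by
    have := (hq0 x).ne'
    field_simp
  simp only [Option.elim_none, Option.elim_some, h1, h2] at hcm
  refine HolderPath.measure_ext ?_
  rw [Measure.map_map (measurable_pi_lambda _ fun x => HolderPath.measurable_eval x) hΦm, hcm]
  congr 1
  funext ω x
  exact hΦ ω x

end CameronMartin

/-! ### Conditional laws and conditional expectations -/

section CondDistrib

variable {Ξ E S : Type*} [MeasurableSpace Ξ] [mE : MeasurableSpace E] [MeasurableSpace S]
  {μ : Measure Ξ} {Y : Ξ → E} {sig : Ξ → S}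

theorem hasCondDistrib_apply_ae_eq [IsFiniteMeasure μ] {κ κ' : Kernel E S} [IsMarkovKernel κ]
    [IsMarkovKernel κ'] (h : HasCondDistrib sig Y κ μ) (h' : HasCondDistrib sig Y κ' μ)
    {A : Set S} (hA : MeasurableSet A) : ∀ᵐ ω ∂(μ.map Y), κ ω A = κ' ω A := by
  refine ae_eq_of_forall_setLIntegral_eq_of_sigmaFinite (κ.measurable_coe hA)
    (κ'.measurable_coe hA) fun s hs _ => ?_
  rw [← Measure.compProd_apply_prod hs hA, ← Measure.compProd_apply_prod hs hA, ← h.map_eq,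
    ← h'.map_eq]

theorem hasCondDistrib_ae_eq [IsFiniteMeasure μ] [MeasurableSpace.CountablyGenerated S]
    {κ κ' : Kernel E S} [IsMarkovKernel κ] [IsMarkovKernel κ'] (h : HasCondDistrib sig Y κ μ)
    (h' : HasCondDistrib sig Y κ' μ) : ∀ᵐ ω ∂(μ.map Y), κ ω = κ' ω :=
  Kernel.ae_eq_of_compProd_eq (h.map_eq.symm.trans h'.map_eq)

variable {κ : Kernel E S} {f : S → ℝ}

theorem integrable_compProd_of_hasCondDistrib (h : HasCondDistrib sig Y κ μ)
    (hf : Integrable f (μ.map sig)) : Integrable (fun z : E × S => f z.2) (μ.map Y ⊗ₘ κ) := by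
  have h2 : μ.map sig = (μ.map Y ⊗ₘ κ).map Prod.snd := by
    rw [← h.map_eq, AEMeasurable.map_map_of_aemeasurable measurable_snd.aemeasurable h.aemeasurable]
    rfl
  rw [h2] at hf
  exact hf.comp_measurable measurable_snd

variable [IsMarkovKernel κ]

/-- A payoff that is integrable is integrable for almost every conditional law. -/
theorem ae_integrable_of_hasCondDistrib [IsFiniteMeasure μ] (h : HasCondDistrib sig Y κ μ)
    (hf : Integrable f (μ.map sig)) : ∀ᵐ ω ∂(μ.map Y), Integrable f (κ ω) := by
  have h1 := integrable_compProd_of_hasCondDistrib h hf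
  exact ((Measure.integrable_compProd_iff h1.aestronglyMeasurable).1 h1).1

/-- The conditional expectation is the integral against the conditional law. -/
theorem condExp_ae_eq_integral_of_hasCondDistrib [IsFiniteMeasure μ] (hY : Measurable Y)
    (hsig : Measurable sig)
    (h : HasCondDistrib sig Y κ μ) (hf : Integrable f (μ.map sig)) {p : E → ℝ} (hp : Measurable p)
    (hpf : ∀ᵐ ω ∂(μ.map Y), p ω = ∫ s, f s ∂(κ ω)) :
    μ[fun ξ => f (sig ξ) | MeasurableSpace.comap Y mE] =ᵐ[μ] fun ξ => p (Y ξ) := by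
  have h1 := integrable_compProd_of_hasCondDistrib h hf
  have hpi : Integrable p (μ.map Y) := by
    have h2 := MeasureTheory.Integrable.integral_compProd (κ := Kernel.const Unit (μ.map Y))
      (η := Kernel.prodMkLeft Unit κ) (a := ()) h1
    exact h2.congr (hpf.mono fun ω hω => hω.symm)
  have hpiY : Integrable (fun ξ => p (Y ξ)) μ := hpi.comp_measurable hY
  symm
  refine ae_eq_condExp_of_forall_setIntegral_eq hY.comap_le (hf.comp_measurable hsig)
    (fun s _ _ => hpiY.integrableOn) ?_
    (hp.comp (comap_measurable Y)).stronglyMeasurable.aestronglyMeasurable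
  rintro _ ⟨t, ht, rfl⟩ -
  have h2 : ∫ z in t ×ˢ Set.univ, f z.2 ∂(μ.map Y ⊗ₘ κ)
      = ∫ ξ in Y ⁻¹' t, f (sig ξ) ∂μ := by
    rw [← h.map_eq, setIntegral_map (ht.prod MeasurableSet.univ)
      (by rw [h.map_eq]; exact h1.aestronglyMeasurable) h.aemeasurable]
    congr 2
    ext ξ
    simp
  rw [← h2, Measure.setIntegral_compProd ht MeasurableSet.univ h1.integrableOn,
    ← setIntegral_map ht hp.aestronglyMeasurable hY.aemeasurable]
  refine setIntegral_congr_ae ht (hpf.mono fun ω hω _ => ?_)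
  rw [hω, setIntegral_univ]

end CondDistrib

/-! ### Bayes' formula for a dominated family of likelihoods -/

section Bayes

variable {Ξ E S : Type*} [MeasurableSpace Ξ] [mE : MeasurableSpace E] [MeasurableSpace S]

/-- The marginal likelihood `∫ L(ω, s) π₀(ds)` of an observation `ω`. -/
noncomputable def evidence (π₀ : Measure S) (L : E → S → ℝ≥0∞) (ω : E) : ℝ≥0∞ :=
  ∫⁻ s, L ω s ∂π₀

/-- The density of the posterior with respect to the prior; the prior itself is kept as the
posterior for those observations whose marginal likelihood is infinite. -/
noncomputable def bayesDensity (π₀ : Measure S) (L : E → S → ℝ≥0∞) (ω : E) (s : S) : ℝ≥0∞ :=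
  if evidence π₀ L ω = ∞ then 1 else (evidence π₀ L ω)⁻¹ * L ω s

/-- The kernel of posteriors, with the prior in place of the posterior for those observations whose
marginal likelihood is infinite. -/
noncomputable def bayesKernel (π₀ : Measure S) [SFinite π₀] (L : E → S → ℝ≥0∞) : Kernel E S :=
  (Kernel.const E π₀).withDensity (bayesDensity π₀ L)

variable {π₀ : Measure S} [IsProbabilityMeasure π₀] {L : E → S → ℝ≥0∞}

theorem measurable_evidence (hL : Measurable (Function.uncurry L)) :
    Measurable (evidence π₀ L) :=
  Measurable.lintegral_prod_right' hL

theorem measurable_bayesDensity (hL : Measurable (Function.uncurry L)) :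
    Measurable (Function.uncurry (bayesDensity π₀ L)) := by
  have hC : Measurable fun z : E × S => evidence π₀ L z.1 :=
    (measurable_evidence hL).comp measurable_fst
  exact Measurable.ite (hC (measurableSet_singleton ∞)) measurable_const (hC.inv.mul hL)

theorem evidence_pos (hL : Measurable (Function.uncurry L)) (hL0 : ∀ ω s, L ω s ≠ 0) (ω : E) :
    0 < evidence π₀ L ω := by
  have hLω : Measurable (L ω) := hL.comp measurable_prodMk_left
  rw [evidence, lintegral_pos_iff_support hLω]
  have : Function.support (L ω) = Set.univ := Set.eq_univ_of_forall fun s => hL0 ω s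
  rw [this, measure_univ]
  exact one_pos

theorem bayesKernel_apply_of_ne_top (hL : Measurable (Function.uncurry L)) {ω : E}
    (hω : evidence π₀ L ω ≠ ∞) :
    bayesKernel π₀ L ω = (evidence π₀ L ω)⁻¹ • π₀.withDensity (L ω) := by
  have hLω : Measurable (L ω) := hL.comp measurable_prodMk_left
  rw [bayesKernel, Kernel.withDensity_apply _ (measurable_bayesDensity hL), Kernel.const_apply,
    ← withDensity_smul _ hLω]
  congr 1
  funext s
  simp [bayesDensity, hω]

theorem bayesKernel_congr (hL : Measurable (Function.uncurry L)) {ω ω' : E}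
    (h : L ω = L ω') : bayesKernel π₀ L ω = bayesKernel π₀ L ω' := by
  rw [bayesKernel, Kernel.withDensity_apply _ (measurable_bayesDensity hL),
    Kernel.withDensity_apply _ (measurable_bayesDensity hL)]
  have h1 : bayesDensity π₀ L ω = bayesDensity π₀ L ω' := by
    funext s
    have h2 : evidence π₀ L ω = evidence π₀ L ω' := by rw [evidence, evidence, h]
    rw [bayesDensity, bayesDensity, h2, h]
  rw [h1, Kernel.const_apply, Kernel.const_apply]

theorem isMarkovKernel_bayesKernel (hL : Measurable (Function.uncurry L))
    (hL0 : ∀ ω s, L ω s ≠ 0) : IsMarkovKernel (bayesKernel π₀ L) := by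
  refine ⟨fun ω => ⟨?_⟩⟩
  by_cases hω : evidence π₀ L ω = ∞
  · rw [bayesKernel, Kernel.withDensity_apply _ (measurable_bayesDensity hL)]
    simp [bayesDensity, hω]
  · rw [bayesKernel_apply_of_ne_top hL hω, Measure.smul_apply, withDensity_apply _ .univ,
      Measure.restrict_univ]
    exact ENNReal.inv_mul_cancel (evidence_pos hL hL0 ω).ne' hω

/-- Posterior means are measurable in the observation: the integrand may be replaced by a strongly
measurable version since posteriors are absolutely continuous with respect to the prior, and the
normalized measure is zero where the marginal likelihood is infinite. -/
theorem measurable_integral_posterior (hL : Measurable (Function.uncurry L)) {f : S → ℝ}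
    (hf : AEStronglyMeasurable f π₀) : Measurable fun ω =>
      ∫ s, f s ∂((evidence π₀ L ω)⁻¹ • π₀.withDensity (L ω)) := by
  have h1 : ∀ ω, ∫ s, f s ∂((evidence π₀ L ω)⁻¹ • π₀.withDensity (L ω))
      = if evidence π₀ L ω = ∞ then 0 else ∫ s, hf.mk f s ∂(bayesKernel π₀ L ω) := by
    intro ω
    split_ifs with hω
    · simp [hω]
    · rw [bayesKernel_apply_of_ne_top hL hω]
      exact integral_congr_ae
        ((withDensity_absolutelyContinuous π₀ (L ω)).smul_left _ |>.ae_le hf.ae_eq_mk)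
  simp_rw [h1]
  exact Measurable.ite (measurable_evidence hL (measurableSet_singleton ∞)) measurable_const
    hf.stronglyMeasurable_mk.integral_kernel.measurable

variable {P₀ : Measure E} [IsProbabilityMeasure P₀] {μ : Measure Ξ}
  {Y : Ξ → E} {sig : Ξ → S}

/-- If for each parameter `s` the transformation `T (·, s)` gives the law of the observation the
density `L · s`, then `L` is the joint density of transformed observation and parameter. -/
theorem map_prod_eq_withDensity_of_forall_map_eq (hL : Measurable (Function.uncurry L))
    {T : E × S → E} (hT : Measurable T)
    (h : ∀ s, P₀.map (fun ω => T (ω, s)) = P₀.withDensity fun ω => L ω s) :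
    (P₀.prod π₀).map (fun z => (T z, z.2)) = (P₀.prod π₀).withDensity (Function.uncurry L) := by
  have hT' : Measurable fun z => (T z, z.2) := hT.prodMk measurable_snd
  refine Measure.ext_of_lintegral _ fun φ hφ => ?_
  have hφT : Measurable fun z => φ (T z, z.2) := hφ.comp hT'
  rw [lintegral_map hφ hT', lintegral_withDensity_eq_lintegral_mul _ hL hφ,
    lintegral_prod_symm _ hφT.aemeasurable, lintegral_prod_symm _ (hL.mul hφ).aemeasurable]
  refine lintegral_congr fun s => ?_
  have hTs : Measurable fun ω => T (ω, s) := hT.comp measurable_prodMk_right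
  have hφs : Measurable fun ω => φ (ω, s) := hφ.comp measurable_prodMk_right
  have hLs : Measurable fun ω => L ω s := hL.comp measurable_prodMk_right
  rw [← lintegral_map hφs hTs, h s, lintegral_withDensity_eq_lintegral_mul _ hLs hφs]
  rfl

theorem map_eq_withDensity_evidence (hY : Measurable Y) (hsig : Measurable sig)
    (hL : Measurable (Function.uncurry L))
    (h : μ.map (fun ξ => (Y ξ, sig ξ)) = (P₀.prod π₀).withDensity (Function.uncurry L)) :
    μ.map Y = P₀.withDensity (evidence π₀ L) := by
  ext t ht
  have h1 : μ.map Y t = μ.map (fun ξ => (Y ξ, sig ξ)) (t ×ˢ Set.univ) := by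
    rw [Measure.map_apply hY ht, Measure.map_apply (hY.prodMk hsig) (ht.prod .univ)]
    congr 1
    ext ξ
    simp
  rw [h1, h, withDensity_apply _ (ht.prod .univ), withDensity_apply _ ht,
    ← Measure.prod_restrict, Measure.restrict_univ, lintegral_prod _ hL.aemeasurable]
  rfl

theorem ae_evidence_ne_top [IsProbabilityMeasure μ] (hY : Measurable Y) (hsig : Measurable sig)
    (hL : Measurable (Function.uncurry L))
    (h : μ.map (fun ξ => (Y ξ, sig ξ)) = (P₀.prod π₀).withDensity (Function.uncurry L)) :
    ∀ᵐ ω ∂P₀, evidence π₀ L ω ≠ ∞ := by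
  have h1 := congrArg (fun ν => ν Set.univ) (map_eq_withDensity_evidence hY hsig hL h)
  have _ : IsProbabilityMeasure (μ.map Y) := Measure.isProbabilityMeasure_map hY.aemeasurable
  simp only [measure_univ, withDensity_apply _ MeasurableSet.univ, Measure.restrict_univ] at h1
  refine (ae_lt_top (measurable_evidence hL) ?_).mono fun ω hω => hω.ne
  rw [← h1]
  exact ENNReal.one_ne_top

/-- **Bayes' formula**: if the joint law of observation and parameter has a density `L` with respect
to a product measure, then the normalized densities are the conditional laws of the parameter. -/
theorem hasCondDistrib_bayesKernel [IsProbabilityMeasure μ] (hY : Measurable Y)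
    (hsig : Measurable sig)
    (hL : Measurable (Function.uncurry L)) (hL0 : ∀ ω s, L ω s ≠ 0)
    (h : μ.map (fun ξ => (Y ξ, sig ξ)) = (P₀.prod π₀).withDensity (Function.uncurry L)) :
    HasCondDistrib sig Y (bayesKernel π₀ L) μ := by
  refine ⟨(hY.prodMk hsig).aemeasurable, ?_⟩
  have hg := measurable_bayesDensity (π₀ := π₀) hL
  have hC := measurable_evidence (π₀ := π₀) hL
  have _ := isMarkovKernel_bayesKernel (π₀ := π₀) hL hL0
  have _ : IsProbabilityMeasure (μ.map Y) := Measure.isProbabilityMeasure_map hY.aemeasurable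
  have hC1 : Measurable fun z : E × S => evidence π₀ L z.1 := hC.comp measurable_fst
  have hfin := ae_evidence_ne_top hY hsig hL h
  have e1 : μ.map Y ⊗ₘ bayesKernel π₀ L
      = (μ.map Y ⊗ₘ Kernel.const E π₀).withDensity (Function.uncurry (bayesDensity π₀ L)) := by
    have : IsSFiniteKernel ((Kernel.const E π₀).withDensity (bayesDensity π₀ L)) :=
      inferInstanceAs (IsSFiniteKernel (bayesKernel π₀ L))
    exact Measure.compProd_withDensity hg
  have _ : SFinite (P₀.withDensity (evidence π₀ L)) := by
    rw [← map_eq_withDensity_evidence hY hsig hL h]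
    infer_instance
  rw [e1, h, Measure.compProd_const, map_eq_withDensity_evidence hY hsig hL h,
    prod_withDensity_left hC, ← withDensity_mul _ hC1 hg]
  refine withDensity_congr_ae ?_
  have h3 : ∀ᵐ z ∂(P₀.prod π₀), evidence π₀ L z.1 ≠ ∞ :=
    Measure.quasiMeasurePreserving_fst.ae hfin
  filter_upwards [h3] with z hz
  simp only [Pi.mul_apply, Function.uncurry, bayesDensity, hz, if_false]
  rw [← mul_assoc, ENNReal.mul_inv_cancel (evidence_pos hL hL0 z.1).ne' hz, one_mul]

end Bayes

end OrderFlow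

/-! ### Quotients of Hölder functions -/

lemma HolderWith.div {X : Type*} [PseudoMetricSpace X] {δ Cw Cq M c : ℝ≥0} {w q : X → ℝ}
    (hw : HolderWith Cw δ w) (hq : HolderWith Cq δ q) (hM : ∀ x, |w x| ≤ M) (hc : 0 < c)
    (hcq : ∀ x, c ≤ q x) :
    HolderWith (Cw / c + M * Cq / c ^ 2) δ fun x => w x / q x := by
  intro x y
  rw [edist_nndist, edist_nndist, ← ENNReal.coe_rpow_of_nonneg _ δ.coe_nonneg, ← ENNReal.coe_mul,
    ENNReal.coe_le_coe, ← NNReal.coe_le_coe]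
  push_cast
  rw [Real.dist_eq]
  have hc' : (0 : ℝ) < c := hc
  have hx : 0 < q x := hc'.trans_le (hcq x)
  have hy : 0 < q y := hc'.trans_le (hcq y)
  have e : w x / q x - w y / q y = (w x - w y) / q x - w y * (q x - q y) / (q x * q y) := by
    field_simp
    ring
  have h1 := hw.dist_le x y
  have h2 := hq.dist_le x y
  rw [Real.dist_eq] at h1 h2
  rw [e]
  refine (abs_sub _ _).trans ?_
  rw [abs_div, abs_div, abs_mul, abs_of_pos hx, abs_of_pos (mul_pos hx hy)]
  have h3 : |w x - w y| / q x ≤ Cw * dist x y ^ (δ : ℝ) / c := by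
    have := hcq x
    gcongr
  have h4 : |w y| * |q x - q y| / (q x * q y) ≤ M * (Cq * dist x y ^ (δ : ℝ)) / (c * c) := by
    have := hcq x
    have := hcq y
    have := hM y
    gcongr
  refine (add_le_add h3 h4).trans_eq ?_
  ring

namespace OrderFlow

lemma abs_le_of_holderNorm_le {X : Type*} [PseudoEMetricSpace X] {δ K : ℝ≥0} {f : X → ℝ}
    (h : holderNorm δ f ≤ K) (x : X) : |f x| ≤ K := by
  have h1 : ‖f x‖ₑ ≤ K := ((le_iSup (fun x => ‖f x‖ₑ) x).trans le_self_add).trans h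
  rw [enorm_eq_nnnorm, ENNReal.coe_le_coe, ← NNReal.coe_le_coe] at h1
  simpa using h1

lemma holderWith_of_holderNorm_le {X : Type*} [MetricSpace X] {δ K : ℝ≥0} {f : X → ℝ}
    (hf : MemHolder δ f) (h : holderNorm δ f ≤ K) : HolderWith K δ f := by
  have h1 : (nnHolderNorm δ f : ℝ≥0∞) ≤ K := by
    rw [hf.coe_nnHolderNorm_eq_eHolderNorm]
    exact le_add_self.trans h
  exact fun x y => (hf.holderWith x y).trans (mul_le_mul_left h1 _)

lemma exists_pos_forall_le_of_continuous {X : Type*} [TopologicalSpace X] [CompactSpace X]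
    {q : X → ℝ} (hq : Continuous q) (hq0 : ∀ x, 0 < q x) :
    ∃ c : ℝ≥0, 0 < c ∧ ∀ x, (c : ℝ) ≤ q x := by
  obtain ⟨c, hc, h⟩ := isCompact_univ.exists_forall_le' hq.continuousOn (a := 0)
    (fun x _ => hq0 x)
  exact ⟨⟨c, hc.le⟩, hc, fun x => h x trivial⟩

lemma memHolder_div {X : Type*} [MetricSpace X] [CompactSpace X] {δ : ℝ≥0} (hδ : 0 < δ)
    {w q : X → ℝ} (hw : MemHolder δ w) (hq : MemHolder δ q) (hq0 : ∀ x, 0 < q x) :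
    MemHolder δ fun x => w x / q x := by
  obtain ⟨c, hc, hcq⟩ := exists_pos_forall_le_of_continuous (hq.holderWith.continuous hδ) hq0
  obtain ⟨M, hM⟩ := isCompact_univ.exists_bound_of_continuousOn
    (hw.holderWith.continuous hδ).continuousOn
  exact (hw.holderWith.div hq.holderWith (M := M.toNNReal)
    (fun x => (hM x trivial).trans (Real.le_coe_toNNReal M)) hc hcq).memHolder

/-! ### Bounds and measurability of the likelihood -/

section Likelihood

variable {a b : ℝ} {γ δ : ℝ≥0} {S : Type*}

lemma measurable_of_tendsto_holderNorm [TopologicalSpace S] [MeasurableSpace S] [BorelSpace S]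
    {X : Type*} [PseudoEMetricSpace X] {W : X → S → ℝ}
    (hW : ∀ s₀, Tendsto (fun s => holderNorm δ fun x => W x s - W x s₀) (𝓝 s₀) (𝓝 0)) (x : X) :
    Measurable (W x) := by
  refine Continuous.measurable (continuous_iff_continuousAt.2 fun s₀ => ?_)
  rw [ContinuousAt, tendsto_iff_edist_tendsto_0]
  refine tendsto_of_tendsto_of_tendsto_of_le_of_le tendsto_const_nhds (hW s₀)
    (fun s => zero_le) fun s => ?_
  rw [edist_eq_enorm_sub]
  exact (le_iSup (fun x => ‖W x s - W x s₀‖ₑ) x).trans le_self_add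

variable {σ : Set.Icc a b → ℝ} {W : Set.Icc a b → S → ℝ}

/-- For beliefs that are bounded in Hölder norm the likelihood of a path is bounded. -/
lemma exists_forall_likelihood_le (hab : a < b) (hδγ : 1 < (δ : ℝ) + γ) (hδ : 0 < δ)
    (hσ : MemHolder δ fun x => σ x ^ 2) (hσ_pos : ∀ x, 0 < σ x ^ 2)
    (hW : ∀ s, MemHolder δ fun x => W x s) {K : ℝ≥0}
    (hK : ∀ s, holderNorm δ (fun x => W x s) ≤ K) (ω : HolderPath a b γ) :
    ∃ R, ∀ s, likelihood σ W ω s ≤ R := by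
  obtain ⟨c, hc, hcq⟩ := exists_pos_forall_le_of_continuous (hσ.holderWith.continuous hδ) hσ_pos
  have hc' : (0 : ℝ) < c := hc
  refine ⟨_, fun s => Real.exp_le_exp.2 ((sub_le_self _ ?_).trans ((le_abs_self _).trans
    (abs_youngIntegral_le hab hδγ ((holderWith_of_holderNorm_le (hW s) (hK s)).div hσ.holderWith
      (abs_le_of_holderNorm_le (hK s)) hc hcq) ω.2.2.holderWith (M := K / c) fun x => ?_)))⟩
  · exact mul_nonneg (by norm_num) (integral_nonneg fun x => by positivity)
  · rw [abs_div, abs_of_pos (hσ_pos x)]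
    exact div_le_div₀ K.2 (abs_le_of_holderNorm_le (hK s) x) hc' (hcq x)

variable [MeasurableSpace S]

lemma measurable_projectionProfile (hab : a < b) (hδγ : 1 < (δ : ℝ) + γ)
    (hWσ : ∀ s, MemHolder δ fun x => W x s / σ x ^ 2) (hWm : ∀ x, Measurable (W x)) :
    Measurable fun z : HolderPath a b γ × S => projectionProfile σ W z.1 z.2 := by
  refine measurable_of_tendsto_metrizable (f := fun n (z : HolderPath a b γ × S) =>
    leftSum (uniformPartition hab n) (fun x => W x z.2 / σ x ^ 2) z.1) (fun n => ?_)
    (tendsto_pi_nhds.2 fun z => tendsto_leftSum_uniformPartition hab hδγ (hWσ z.2) z.1)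
  have h1 : ∀ x : Set.Icc a b, Measurable fun z : HolderPath a b γ × S => z.1 x := fun x =>
    (HolderPath.measurable_eval x).comp measurable_fst
  exact Finset.measurable_fun_sum _ fun k _ =>
    (((hWm _).comp measurable_snd).div_const _).mul ((h1 _).sub (h1 _))

lemma measurable_likelihood (hab : a < b) (hδγ : 1 < (δ : ℝ) + γ)
    (hWσ : ∀ s, MemHolder δ fun x => W x s / σ x ^ 2) (hWm : ∀ x, Measurable (W x))
    (hWc : ∀ s, Continuous fun x => W x s) (hσ : Continuous fun x => σ x ^ 2) :
    Measurable (Function.uncurry fun (ω : HolderPath a b γ) s =>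
      ENNReal.ofReal (likelihood σ W ω s)) := by
  have h1 : Measurable (Function.uncurry W) :=
    measurable_uncurry_of_continuous_of_measurable hWc hWm
  have h2 : StronglyMeasurable fun s => ∫ x : Set.Icc a b, W x s ^ 2 / σ x ^ 2 ∂(lebesgue a b) := by
    refine StronglyMeasurable.integral_prod_right (f := fun s x => W x s ^ 2 / σ x ^ 2)
      (Measurable.stronglyMeasurable ?_)
    exact ((h1.comp measurable_swap).pow_const 2).div (hσ.measurable.comp measurable_snd)
  have h3 := measurable_projectionProfile (γ := γ) hab hδγ hWσ hWm
  exact (h3.sub ((h2.measurable.comp measurable_snd).const_mul _)).exp.ennreal_ofReal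

end Likelihood

/-! ### The joint law of order flow and signal -/

section JointLaw

variable {a b : ℝ} {γ δ : ℝ≥0}

lemma exists_holderPath_add_integral (hγ : γ ≤ 1) {w : Set.Icc a b → ℝ} (hw : Continuous w)
    (ω : HolderPath a b γ) :
    ∃ ω' : HolderPath a b γ, ∀ x, ω' x = ω x + ∫ y in Set.Iic x, w y ∂(lebesgue a b) := by
  obtain ⟨v, hv⟩ := exists_holderPath_integral hγ hw
  refine ⟨⟨ω.1 + v.1, fun x hx => ?_, ω.2.2.add v.2.2⟩, fun x => ?_⟩
  · rw [ContinuousMap.add_apply, ω.2.1 x hx, v.2.1 x hx, add_zero]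
  · rw [← hv x]
    rfl

lemma HolderPath.ext {ω ω' : HolderPath a b γ} (h : ∀ x, ω x = ω' x) : ω = ω' :=
  Subtype.ext (ContinuousMap.ext h)

variable {Ξ S : Type*} [MeasurableSpace Ξ] [MeasurableSpace S] {μ : Measure Ξ}
  {σ : Set.Icc a b → ℝ} {W : Set.Icc a b → S → ℝ}

/-- If the order flow is noise plus a drift that depends on an independent signal, then order flow
and signal have the likelihood as joint density with respect to the product of the law of the noise
and the law of the signal. -/
theorem map_prodMk_eq_withDensity_likelihood [IsProbabilityMeasure μ] (hab : a < b)
    (hδγ : 1 < (δ : ℝ) + γ) (hγ : γ ≤ 1)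
    (hWσ : ∀ s, MemHolder δ fun x => W x s / σ x ^ 2) (hWm : ∀ x, Measurable (W x))
    (hWc : ∀ s, Continuous fun x => W x s) (hσ : Continuous fun x => σ x ^ 2)
    (hσ_pos : ∀ x, 0 < σ x ^ 2) {M Y : Ξ → HolderPath a b γ} {sig : Ξ → S} (hM : Measurable M)
    (hsig : Measurable sig) (hindep : IndepFun M sig μ)
    (hG : IsCenteredGaussian (fun x (ω : HolderPath a b γ) => ω x)
      (fun x y => ∫ u in Set.Iic (min x y), σ u ^ 2 ∂(lebesgue a b)) (μ.map M))
    (hY : ∀ ξ x, Y ξ x = M ξ x + ∫ y in Set.Iic x, W y (sig ξ) ∂(lebesgue a b)) :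
    μ.map (fun ξ => (Y ξ, sig ξ)) = ((μ.map M).prod (μ.map sig)).withDensity
      (Function.uncurry fun ω s => ENNReal.ofReal (likelihood σ W ω s)) := by
  have _ : IsProbabilityMeasure (μ.map M) := Measure.isProbabilityMeasure_map hM.aemeasurable
  have _ : IsProbabilityMeasure (μ.map sig) := Measure.isProbabilityMeasure_map hsig.aemeasurable
  have hLm := measurable_likelihood (γ := γ) hab hδγ hWσ hWm hWc hσ
  have hWu : Measurable (Function.uncurry W) :=
    measurable_uncurry_of_continuous_of_measurable hWc hWm
  choose T hT using fun z : HolderPath a b γ × S =>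
    exists_holderPath_add_integral hγ (hWc z.2) z.1
  have hTm : Measurable T := by
    refine HolderPath.measurable_of_eval fun x => ?_
    have h2 : StronglyMeasurable fun s => ∫ y in Set.Iic x, W y s ∂(lebesgue a b) :=
      StronglyMeasurable.integral_prod_right (f := fun s y => W y s)
        (hWu.comp measurable_swap).stronglyMeasurable
    simp_rw [hT]
    exact ((HolderPath.measurable_eval x).comp measurable_fst).add
      (h2.measurable.comp measurable_snd)
  have hYT : (fun ξ => (Y ξ, sig ξ)) = (fun z => (T z, z.2)) ∘ fun ξ => (M ξ, sig ξ) := by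
    funext ξ
    exact Prod.ext (HolderPath.ext fun x => (hY ξ x).trans (hT (M ξ, sig ξ) x).symm) rfl
  have hTm' : Measurable fun z => (T z, z.2) := hTm.prodMk measurable_snd
  rw [hYT, ← Measure.map_map hTm' (hM.prodMk hsig),
    (indepFun_iff_map_prod_eq_prod_map_map hM.aemeasurable hsig.aemeasurable).1 hindep]
  exact map_prod_eq_withDensity_of_forall_map_eq hLm hTm fun s =>
    map_shift_eq_withDensity hab hδγ (hWσ s) ((hWc s).div hσ fun x => (hσ_pos x).ne') hσ hσ_pos hG
      (hTm.comp measurable_prodMk_right) fun ω x => hT (ω, s) x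

variable {B : ℝ≥0 → Ξ → ℝ}

/-- Subtracting the drift from the order flow leaves a path-valued version of the noise. -/
lemma exists_noise (hγ : γ ≤ 1) {D : Set.Icc a b → Ξ → ℝ} (hD : ∀ ξ, Continuous fun x => D x ξ)
    (hDm : ∀ x : Set.Icc a b, Measurable fun ξ => ∫ y in Set.Iic x, D y ξ ∂(lebesgue a b))
    {Y : Ξ → HolderPath a b γ} (hYm : Measurable Y) (hY : IsOrderFlow μ σ B D Y) :
    ∃ M : Ξ → HolderPath a b γ, Measurable M ∧ (∀ x, IsItoIntegral μ σ B x fun ξ => M ξ x) ∧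
      ∀ ξ x, Y ξ x = M ξ x + ∫ y in Set.Iic x, D y ξ ∂(lebesgue a b) := by
  choose M hM using fun ξ => exists_holderPath_add_integral hγ (hD ξ).neg (Y ξ)
  have hM' : ∀ ξ x, M ξ x = Y ξ x - ∫ y in Set.Iic x, D y ξ ∂(lebesgue a b) := fun ξ x => by
    rw [hM, Pi.neg_def, integral_neg, sub_eq_add_neg]
  refine ⟨M, HolderPath.measurable_of_eval fun x => ?_, fun x => ?_, fun ξ x => ?_⟩
  · simp_rw [hM']
    exact ((HolderPath.measurable_eval x).comp hYm).sub (hDm x)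
  · simp_rw [hM']
    exact hY x
  · rw [hM', sub_add_cancel]

/-- Two path-valued versions of the noise have the same law, as limits in probability are unique. -/
lemma map_noise_eq [IsProbabilityMeasure μ] (hab : a < b) {M M' : Ξ → HolderPath a b γ}
    (hM : Measurable M) (hM' : Measurable M') (h : ∀ x, IsItoIntegral μ σ B x fun ξ => M ξ x)
    (h' : ∀ x, IsItoIntegral μ σ B x fun ξ => M' ξ x) : μ.map M = μ.map M' := by
  have hm : Measurable (fun (ω : HolderPath a b γ) (x : Set.Icc a b) => ω x) :=
    measurable_pi_lambda _ fun x => HolderPath.measurable_eval x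
  have _ := meshFilter_neBot hab
  refine HolderPath.measure_ext ?_
  rw [Measure.map_map hm hM, Measure.map_map hm hM']
  exact map_eq_of_forall_ae_eq (X := fun x ξ => M ξ x) (Y := fun x ξ => M' ξ x)
    (hm.comp hM).aemeasurable (hm.comp hM').aemeasurable
    fun x => tendstoInMeasure_ae_unique (h x) (h' x)

lemma indepFun_noise (hab : a < b) {sig : Ξ → S} (hindep : IndepFun sig (fun ξ t => B t ξ) μ)
    {M : Ξ → HolderPath a b γ} (h : ∀ x, IsItoIntegral μ σ B x fun ξ => M ξ x) :
    IndepFun M sig μ := by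
  have h1 := indepFun_of_isItoIntegral hab hindep h
  have h2 : (inferInstance : MeasurableSpace (HolderPath a b γ)).comap M
      = MeasurableSpace.comap (fun ξ (x : Set.Icc a b) => M ξ x) inferInstance := by
    rw [HolderPath.measurableSpace_eq_comap, MeasurableSpace.comap_comp]
    rfl
  rw [IndepFun_iff_Indep] at h1 ⊢
  rw [h2]
  exact h1.symm

end JointLaw

end OrderFlow

/-! ### The posterior of the market maker -/

theorem mainTheorem3
    {S : Type*} [TopologicalSpace S] [MeasurableSpace S] [BorelSpace S]
    (π₀ : Measure S) [IsProbabilityMeasure π₀]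
    {a b : ℝ} (hab : a < b)
    (γ δ : ℝ≥0) (hγ : 1 / 3 < γ) (hγ' : γ < 1 / 2) (hδ : δ ≤ 1) (hγδ : 1 < δ + γ)
    -- the squared noise intensity
    (σ : Set.Icc a b → ℝ) (hσ : MemHolder δ (fun x => σ x ^ 2)) (hσ_pos : ∀ x, 0 < σ x ^ 2)
    -- the market maker's belief, continuous in the signal as a map into the Hölder space
    (W : Set.Icc a b → S → ℝ) (hW : ∀ s, MemHolder δ (fun x => W x s))
    (hW_cont : ∀ s₀, Tendsto (fun s => holderNorm δ (fun x => W x s - W x s₀)) (𝓝 s₀) (𝓝 0))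
    -- the model under the belief: signal, independent Brownian noise, combined order flow
    {Ξ : Type*} [MeasurableSpace Ξ] (μ : Measure Ξ) [IsProbabilityMeasure μ]
    (sig : Ξ → S) (hsig : Measurable sig) (hsig_law : μ.map sig = π₀)
    (B : ℝ≥0 → Ξ → ℝ) (hB : IsBrownianReal B μ)
    (hindep : IndepFun sig (fun ξ t => B t ξ) μ)
    (Y : Ξ → HolderPath a b γ) (hY : Measurable Y)
    (hY_eq : IsOrderFlow μ σ B (fun x ξ => W x (sig ξ)) Y)
    -- conditional payoffs of the securities given the signal
    (η : Set.Icc a b → S → ℝ) :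
    -- the pathwise integral exists for every path and every signal
    (∀ (ω : HolderPath a b γ) (s : S),
      HasYoungIntegral (fun x => W x s / σ x ^ 2) ω (projectionProfile σ W ω s)) ∧
    -- the normalizing constant is positive, and finite for almost every order flow generated by an
    -- arbitrary portfolio, for almost every order flow under the belief, and for every path if the
    -- belief is bounded in the Hölder norm
    (∀ ω : HolderPath a b γ, 0 < normalizer σ W π₀ ω) ∧
    (∀ V : Set.Icc a b → ℝ, MemHolder δ V →
      ∀ Z : Ξ → HolderPath a b γ, Measurable Z → IsOrderFlow μ σ B (fun x _ => V x) Z →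
        ∀ᵐ ω ∂(μ.map Z), normalizer σ W π₀ ω ≠ ∞) ∧
    (∀ᵐ ω ∂(μ.map Y), normalizer σ W π₀ ω ≠ ∞) ∧
    ((∃ K : ℝ≥0, ∀ s, holderNorm δ (fun x => W x s) ≤ K) →
      ∀ ω : HolderPath a b γ, normalizer σ W π₀ ω ≠ ∞) ∧
    -- the exponential tilt is a probability measure
    (∀ ω : HolderPath a b γ, normalizer σ W π₀ ω ≠ ∞ →
      IsProbabilityMeasure (posterior σ W π₀ ω)) ∧
    -- it is the conditional law of the signal given the order flow, and it depends on the path only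
    -- through the projection profile
    (∃ κ : Kernel (HolderPath a b γ) S, IsMarkovKernel κ ∧ HasCondDistrib sig Y κ μ ∧
      (∀ ω, normalizer σ W π₀ ω ≠ ∞ → κ ω = posterior σ W π₀ ω) ∧
      (∀ ω ω', projectionProfile σ W ω = projectionProfile σ W ω' → κ ω = κ ω')) ∧
    (∀ ω ω' : HolderPath a b γ, projectionProfile σ W ω = projectionProfile σ W ω' →
      posterior σ W π₀ ω = posterior σ W π₀ ω') ∧
    -- every version of the conditional law of the signal given the order flow agrees with it
    (∀ κ : Kernel (HolderPath a b γ) S, IsMarkovKernel κ → HasCondDistrib sig Y κ μ →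
      (∀ A, MeasurableSet A → ∀ᵐ ω ∂(μ.map Y), κ ω A = posterior σ W π₀ ω A) ∧
      (MeasurableSpace.CountablyGenerated S → ∀ᵐ ω ∂(μ.map Y), κ ω = posterior σ W π₀ ω)) ∧
    -- the zero-profit prices are the posterior means
    (∀ x : Set.Icc a b, Integrable (η x) π₀ →
      (∀ᵐ ω ∂(μ.map Y), Integrable (η x) (posterior σ W π₀ ω)) ∧
      IsZeroProfitPrice μ Y (fun ξ => η x (sig ξ))
        (fun ω => ∫ s, η x s ∂(posterior σ W π₀ ω)) ∧
      (∀ p : HolderPath a b γ → ℝ, IsZeroProfitPrice μ Y (fun ξ => η x (sig ξ)) p →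
        ∀ᵐ ω ∂(μ.map Y), p ω = ∫ s, η x s ∂(posterior σ W π₀ ω))) := by
  have hδ0 : 0 < δ := by
    have h1 : γ < 1 := hγ'.trans (NNReal.half_lt_self one_ne_zero)
    exact pos_of_lt_add_left (h1.trans hγδ)
  have hγ1 : γ ≤ 1 := (hγ'.trans (NNReal.half_lt_self one_ne_zero)).le
  have hδγ : 1 < (δ : ℝ) + γ := by exact_mod_cast hγδ
  have hσc : Continuous fun x => σ x ^ 2 := hσ.holderWith.continuous hδ0
  have hWc : ∀ s, Continuous fun x => W x s := fun s => (hW s).holderWith.continuous hδ0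
  have hWσ : ∀ s, MemHolder δ fun x => W x s / σ x ^ 2 := fun s =>
    memHolder_div hδ0 (hW s) hσ hσ_pos
  have hWm : ∀ x, Measurable (W x) := measurable_of_tendsto_holderNorm hW_cont
  have hWi : ∀ x : Set.Icc a b, Measurable fun s => ∫ y in Set.Iic x, W y s ∂(lebesgue a b) :=
    fun x => (StronglyMeasurable.integral_prod_right (f := fun s y => W y s)
      ((measurable_uncurry_of_continuous_of_measurable hWc hWm).comp
        measurable_swap).stronglyMeasurable).measurable
  have hL := measurable_likelihood (γ := γ) hab hδγ hWσ hWm hWc hσc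
  have hL0 : ∀ (ω : HolderPath a b γ) s, ENNReal.ofReal (likelihood σ W ω s) ≠ 0 := fun ω s =>
    (ENNReal.ofReal_pos.2 (Real.exp_pos _)).ne'
  have hlik : ∀ ω ω' : HolderPath a b γ, projectionProfile σ W ω = projectionProfile σ W ω' →
      likelihood σ W ω = likelihood σ W ω' := fun ω ω' h => by
    funext s
    rw [likelihood, likelihood, h]
  -- the noise part of the order flow and the joint law of order flow and signal
  obtain ⟨M, hM, hMJ, hYM⟩ := exists_noise hγ1 (fun ξ => hWc (sig ξ))
    (fun x => (hWi x).comp hsig) hY hY_eq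
  have hG : IsCenteredGaussian (fun x (ω : HolderPath a b γ) => ω x)
      (fun x y => ∫ u in Set.Iic (min x y), σ u ^ 2 ∂(lebesgue a b)) (μ.map M) :=
    IsCenteredGaussian.map hM HolderPath.measurable_eval
      (isCenteredGaussian_of_isItoIntegral hab hB.toIsPreBrownianReal hσc hMJ)
  have _ : IsProbabilityMeasure (μ.map M) := Measure.isProbabilityMeasure_map hM.aemeasurable
  have hjoint := map_prodMk_eq_withDensity_likelihood hab hδγ hγ1 hWσ hWm hWc hσc hσ_pos hM hsig
    (indepFun_noise hab hindep hMJ) hG hYM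
  rw [hsig_law] at hjoint
  have hfin := ae_evidence_ne_top hY hsig hL hjoint
  have hfinY : ∀ᵐ ω ∂(μ.map Y), normalizer σ W π₀ ω ≠ ∞ := by
    rw [map_eq_withDensity_evidence hY hsig hL hjoint]
    exact (withDensity_absolutelyContinuous _ _).ae_le hfin
  have _ := isMarkovKernel_bayesKernel (π₀ := π₀) hL hL0
  have hκ := hasCondDistrib_bayesKernel hY hsig hL hL0 hjoint
  have hκ_eq : ∀ ω : HolderPath a b γ, normalizer σ W π₀ ω ≠ ∞ →
      bayesKernel π₀ (fun (ω : HolderPath a b γ) s => ENNReal.ofReal (likelihood σ W ω s)) ω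
        = posterior σ W π₀ ω := fun ω hω => bayesKernel_apply_of_ne_top hL hω
  refine ⟨fun ω s => hasYoungIntegral_youngIntegral hab hδγ (hWσ s) ω.2.2,
    fun ω => evidence_pos hL hL0 ω, fun V hV Z hZ hZ_eq => ?_, hfinY, ?_, fun ω hω => ?_,
    ⟨_, inferInstance, hκ, hκ_eq, fun ω ω' h => bayesKernel_congr hL ?_⟩, fun ω ω' h => ?_,
    fun κ hκM hκ' => ⟨fun A hA => ?_, fun hS => ?_⟩, fun x hx => ?_⟩
  · -- the law of `Z` is a shift of the law of the noise, hence absolutely continuous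
    have hVc : Continuous V := hV.holderWith.continuous hδ0
    obtain ⟨N, hN, hNJ, hZN⟩ := exists_noise hγ1 (fun _ => hVc) (fun _ => measurable_const) hZ hZ_eq
    choose T hT using exists_holderPath_add_integral (γ := γ) hγ1 hVc
    have hTm : Measurable T := HolderPath.measurable_of_eval fun y => by
      simp_rw [hT]
      exact (HolderPath.measurable_eval y).add_const _
    have hZT : Z = T ∘ N := funext fun ξ =>
      HolderPath.ext fun y => (hZN ξ y).trans (hT (N ξ) y).symm
    rw [hZT, ← Measure.map_map hTm hN, map_noise_eq hab hN hM hNJ hMJ,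
      map_shift_eq_withDensity hab hδγ (memHolder_div hδ0 hV hσ hσ_pos)
        (hVc.div hσc fun y => (hσ_pos y).ne') hσc hσ_pos hG hTm hT]
    exact (withDensity_absolutelyContinuous _ _).ae_le hfin
  · rintro ⟨K, hK⟩ ω
    obtain ⟨R, hR⟩ := exists_forall_likelihood_le hab hδγ hδ0 hσ hσ_pos hW hK ω
    refine ((lintegral_mono fun s => ENNReal.ofReal_le_ofReal (hR s)).trans_lt ?_).ne
    rw [lintegral_const, measure_univ, mul_one]
    exact ENNReal.ofReal_lt_top
  · rw [← hκ_eq ω hω]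
    infer_instance
  · simp only [hlik ω ω' h]
  · simp only [OrderFlow.posterior, normalizer, hlik ω ω' h]
  · filter_upwards [hasCondDistrib_apply_ae_eq hκ' hκ hA, hfinY] with ω h1 h2
    rw [h1, hκ_eq ω h2]
  · filter_upwards [hasCondDistrib_ae_eq hκ' hκ, hfinY] with ω h1 h2
    rw [h1, hκ_eq ω h2]
  · rw [← hsig_law] at hx
    have hpm : Measurable fun ω : HolderPath a b γ => ∫ s, η x s ∂(posterior σ W π₀ ω) :=
      measurable_integral_posterior hL (hsig_law ▸ hx.aestronglyMeasurable)
    have hce := condExp_ae_eq_integral_of_hasCondDistrib hY hsig hκ hx hpm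
      (hfinY.mono fun ω hω => by rw [hκ_eq ω hω])
    refine ⟨?_, ⟨hx.comp_measurable hsig, hpm, hce⟩, fun p hp => ?_⟩
    · filter_upwards [ae_integrable_of_hasCondDistrib hκ hx, hfinY] with ω h1 h2
      rwa [← hκ_eq ω h2]
    · rw [ae_map_iff hY.aemeasurable (measurableSet_eq_fun hp.2.1 hpm)]
      exact hp.2.2.symm.trans hce
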